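/- **Setting.** Equip $\mathbb R^m$ and $\mathbb R^n$ with arbitrary norms, $\mathbb R^m\times\mathbb R^n$ with $\|(x,y)\|=\sqrt{\|x\|^2+\|y\|^2}$, and write $\|\cdot\|_*$ for dual norms. Let $\mathcal X\subset\mathbb R^m$, $\mathcal Y\subset\mathbb R^n$ be nonempty closed convex sets, $\mathcal Z=\mathcal X\times\mathcal Y$, let $h_1:\mathbb R^m\to(-\infty,+\infty]$ and $h_2:\mathbb R^n\to(-\infty,+\infty]$ be proper closed convex, let $p\ge 3$, and let $f$ be $C^p$ on an open set containing $\mathcal Z$, convex in $x$ and concave in $y$ on $\mathcal Z$. Put $\ell(x,y)=f(x,y)+h_1(x)-h_2(y)$ and suppose that $\ell$ has a saddle point on $\mathcal Z$, that is, a point $z^*=(x^*,y^*)\in\mathcal Z$ with $h_1(x^*),h_2(y^*)<\infty$ and $\ell(x^*,y)\le\ell(x^*,y^*)\le\ell(x,y^*)$ for all $(x,y)\in\mathcal Z$. Let $$F(z)=\begin{bmatrix}\nabla_x f(x,y)\\-\nabla_y f(x,y)\end{bmatrix},\qquad H(z)=\begin{bmatrix}\partial h_1(x)+N_{\mathcal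 X}(x)\\ \partial h_2(y)+N_{\mathcal Y}(y)\end{bmatrix},\qquad \mathrm{res}(z)=\inf_{w\in H(z)}\|F(z)+w\|_*,$$ where $N_{\mathcal X},N_{\mathcal Y}$ are the normal cones and $\inf\emptyset=+\infty$. Assume that $F$ is $p$-th-order $L_p$-smooth on $\mathcal Z$: $\|D^{p-1}F(z)-D^{p-1}F(z')\|_{\mathrm{op}}\le L_p\|z-z'\|$ for $z,z'\in\mathcal Z$. Let $\Phi(x,y)=\Phi_{\mathcal X}(x)+\Phi_{\mathcal Y}(y)$, where $\Phi_{\mathcal X}$, $\Phi_{\mathcal Y}$ are differentiable at the points of $\mathcal X$, $\mathcal Y$ and $1$-strongly convex there with respect to the respective norms, and assume that $\Phi$ is $L_\Phi$-smooth: $\|\nabla\Phi(z)-\nabla\Phi(z')\|_*\le L_\Phi\|z-z'\|$ on $\mathcal Z$. Here $L_p,L_\Phi\ge 0$. Let $D_\Phi(z',z)=\Phi(z')-\Phi(z)-\langle\nabla\Phi(z),z'-z\rangle$ and $$T_\lambda^{(p-1)}(z';z)=\sum_{i=0}^{p-1}\frac1{i!}D^iF(z)[z'-z]^i+\frac{\lambda}{(p-1)!}\bigl(2D_\Phi(z',z)\bigr)^{\frac{p-1}2}\bigl(\nabla\Phi(z')-\nabla\Phi(z)\bigr).$$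 **The $p$-th-order optimistic method.** The inputs are $z_0\in\mathcal Z$, $\sigma_0>0$, $\lambda\ge L_p$, $\alpha,\beta\in(0,1)$, $\epsilon>0$. In iteration $k=0,1,\dots$ put $v_0=0$ and $v_k=\eta_{k-1}\bigl(F(z_k)-T_\lambda^{(p-1)}(z_k;z_{k-1})\bigr)$ for $k\ge1$. For $\eta>0$ let $z(\eta)$ be the point returned by the subproblem solver, i.e. the solution of $$0\in\eta T_\lambda^{(p-1)}(z;z_k)+v_k+\eta H(z)+\nabla\Phi(z)-\nabla\Phi(z_k),$$ and call $\eta$ admissible if $\eta\|F(z(\eta))-T_\lambda^{(p-1)}(z(\eta);z_k)\|_*\le\frac\alpha2\|z(\eta)-z_k\|$, and inadmissible otherwise. The stepsize $\eta_k$ is found from the trial stepsize $\sigma=\sigma_k$ as follows. - If $\sigma$ is inadmissible (backtracking): start with $\eta_{\rm up}=\sigma$, $\eta=\beta\sigma$; while $\eta$ is inadmissible, set $\eta_{\rm up}\leftarrow\eta$, then $\eta\leftarrow\beta\eta^2/\sigma$; then set $\eta_{\rm lo}=\eta$ and bisect. - If $\sigma$ is admissible (advancing): start with $\eta_{\rm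 lo}=\sigma$, $\eta=\sigma/\beta$; while $\mathrm{res}(z(\eta_{\rm lo}))>\epsilon$ and $\eta$ is admissible, set $\eta_{\rm lo}\leftarrow\eta$, then $\eta\leftarrow\eta^2/(\beta\sigma)$; then set $\eta_{\rm up}=\eta$. If $\mathrm{res}(z(\eta_{\rm lo}))\le\epsilon$, take $\eta_k=\eta_{\rm lo}$; otherwise bisect. - Bisection: while $\eta_{\rm up}/\eta_{\rm lo}>1/\beta$, replace $\eta_{\rm lo}$ by $\sqrt{\eta_{\rm lo}\eta_{\rm up}}$ if this stepsize is admissible, and $\eta_{\rm up}$ by it otherwise; then take $\eta_k=\eta_{\rm lo}$. Then $z_{k+1}=z(\eta_k)$. If $\mathrm{res}(z_{k+1})\le\epsilon$ the method stops and returns $z_{k+1}$; otherwise $\sigma_{k+1}=\eta_k/\beta$. **Theorem.** Let $z_0,\dots,z_N$ be iterates generated by $N\ge 0$ iterations of this method, and let $z^*$ be a saddle point. Then $$D_\Phi(z^*,z_k)\le\frac{2}{2-\alpha}D_\Phi(z^*,z_0)\qquad(0\le k\le N).$$ Moreover, if $N\ge1$, then either $\mathrm{res}(z_N)\le\epsilon$,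 or for every $z=(x,y)\in\mathcal X\times\mathcal Y$ $$\ell(\bar x_N,y)-\ell(x,\bar y_N)\le\gamma_p^{\,p-1}\,L_p(\Phi,\lambda)\,D_\Phi(z,z_0)\,\bigl(D_\Phi(z^*,z_0)\bigr)^{\frac{p-1}2}N^{-\frac{p+1}2},$$ where $(\bar x_N,\bar y_N)=\bigl(\sum_{k=0}^{N-1}\eta_k\bigr)^{-1}\sum_{k=0}^{N-1}\eta_kz_{k+1}$, $L_p(\Phi,\lambda)=L_p+pL_\Phi^{\frac{p+1}2}\lambda$ and $$\gamma_p=\sqrt{\tfrac{2}{1-\alpha}}\,L_\Phi^{3/2}\Bigl(\tfrac{2}{p!\,\alpha\beta^p}\Bigr)^{\frac1{p-1}}+\tfrac{1}{\sqrt{2(1-\alpha)}}\Bigl(\tfrac{2}{p!\,\alpha\beta^p}\Bigr)^{\frac1{p-1}}\alpha\bigl(\beta+L_\Phi^{1/2}\bigr).$$ -/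

import Mathlib

open Set WithLp
open scoped ENNReal Nat

namespace HighOrderOptimistic

noncomputable section

/-! ### Convex analysis with respect to an arbitrary norm

A space `ℝᵐ` with an arbitrary norm is a finite-dimensional real normed space `E`.  Gradients and
(sub)gradients are elements of the dual `StrongDual ℝ E`, whose norm is the dual norm. -/

section Convex

variable {E : Type*} [NormedAddCommGroup E] [NormedSpace ℝ E]

/-- `h : E → (-∞, +∞]` is proper, closed (lower semicontinuous) and convex (convex epigraph). -/
structure IsProperClosedConvex (h : E → EReal) : Prop where
  ne_bot : ∀ x, h x ≠ ⊥
  exists_ne_top : ∃ x, h x ≠ ⊤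
  closed : LowerSemicontinuous h
  convex : Convex ℝ {q : E × ℝ | h q.1 ≤ (q.2 : EReal)}

/-- The subdifferential `∂h(x)`. -/
def subdifferential (h : E → EReal) (x : E) : Set (StrongDual ℝ E) :=
  {g | ∀ x', h x + ((g (x' - x) : ℝ) : EReal) ≤ h x'}

/-- The normal cone `N_S(x)`, empty when `x ∉ S`. -/
def normalCone (S : Set E) (x : E) : Set (StrongDual ℝ E) :=
  {v | x ∈ S ∧ ∀ x' ∈ S, v (x' - x) ≤ 0}

/-- The Bregman distance `D_Φ(z', z) = Φ(z') - Φ(z) - ⟨∇Φ(z), z' - z⟩`. -/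
def bregman (Φ : E → ℝ) (z' z : E) : ℝ :=
  Φ z' - Φ z - fderiv ℝ Φ z (z' - z)

/-- `Φ` is differentiable and 1-strongly convex with respect to the norm on `S`. -/
def IsMirrorMapOn (Φ : E → ℝ) (S : Set E) : Prop :=
  (∀ x ∈ S, DifferentiableAt ℝ Φ x) ∧
    ∀ x ∈ S, ∀ x' ∈ S, Φ x + fderiv ℝ Φ x (x' - x) + ‖x' - x‖ ^ 2 / 2 ≤ Φ x'

/-- `Φ` is `L`-smooth on `S`: its gradient is `L`-Lipschitz on `S`. -/
def IsGradLipschitzOn (Φ : E → ℝ) (L : ℝ) (S : Set E) : Prop :=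
  0 ≤ L ∧ ∀ z ∈ S, ∀ z' ∈ S, ‖fderiv ℝ Φ z - fderiv ℝ Φ z'‖ ≤ L * ‖z - z'‖

/-- The operator `F` is `p`-th-order `L`-smooth on `S`: its `(p-1)`-th derivative is `L`-Lipschitz on
`S` in the operator norm induced by the norm of `E` and its dual norm. -/
def IsHighOrderSmoothOn (p : ℕ) (F : E → StrongDual ℝ E) (L : ℝ) (S : Set E) : Prop :=
  0 ≤ L ∧ ∀ z ∈ S, ∀ z' ∈ S,
    ‖iteratedFDeriv ℝ (p - 1) F z - iteratedFDeriv ℝ (p - 1) F z'‖ ≤ L * ‖z - z'‖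

/-- The `q`-th-order Taylor expansion `T^{(q)}(z'; z)` of `F` at `z`, evaluated at `z'`. -/
def taylorExp (q : ℕ) (F : E → StrongDual ℝ E) (z' z : E) : StrongDual ℝ E :=
  ∑ i ∈ Finset.range (q + 1), (1 / (i ! : ℝ)) • iteratedFDeriv ℝ i F z (fun _ => z' - z)

/-- The regularized Taylor expansion `T_λ^{(p-1)}(z'; z)` of `F` at `z`, evaluated at `z'`. -/
def regTaylor (p : ℕ) (F : E → StrongDual ℝ E) (Φ : E → ℝ) (lam : ℝ) (z' z : E) :
    StrongDual ℝ E :=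
  taylorExp (p - 1) F z' z +
    (lam / ((p - 1)! : ℝ) * (2 * bregman Φ z' z) ^ (((p : ℝ) - 1) / 2)) •
      (fderiv ℝ Φ z' - fderiv ℝ Φ z)

/-- The residual `res(z) = inf_{w ∈ H(z)} ‖F(z) + w‖_*`, equal to `+∞` if `H(z)` is empty. -/
def residual (F : E → StrongDual ℝ E) (H : E → Set (StrongDual ℝ E)) (z : E) : ℝ≥0∞ :=
  ⨅ w ∈ H z, ENNReal.ofReal ‖F z + w‖

end Convex

/-! ### The line search -/

section LineSearch

variable {V : Type*} [NormedAddCommGroup V] [NormedSpace ℝ V]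

/-- The data of one line search: the operators `F` and `H`, the mirror map, the approximation `P` of
`F`, the vector `v⁻`, the current point `z⁻`, the parameters `α`, `β` and the accuracy `ε`. -/
structure LineSearchData (V : Type*) [NormedAddCommGroup V] [NormedSpace ℝ V] where
  F : V → StrongDual ℝ V
  H : V → Set (StrongDual ℝ V)
  Φ : V → ℝ
  P : V → StrongDual ℝ V
  v : StrongDual ℝ V
  zm : V
  α : ℝ
  β : ℝ
  ε : ℝ

namespace LineSearchData

variable (d : LineSearchData V)

/-- `z = z(η; z⁻)` is what the subsolver returns for the stepsize `η`, namely the solution of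
`0 ∈ η P(z) + v⁻ + η H(z) + ∇Φ(z) - ∇Φ(z⁻)`. -/
def IsSolution (η : ℝ) (z : V) : Prop :=
  ∃ w ∈ d.H z, η • d.P z + d.v + η • w + fderiv ℝ d.Φ z - fderiv ℝ d.Φ d.zm = 0

/-- The stepsize condition `η ‖F(z) - P(z)‖_* ≤ (α / 2) ‖z - z⁻‖`. -/
def StepCondition (η : ℝ) (z : V) : Prop :=
  η * ‖d.F z - d.P z‖ ≤ d.α / 2 * ‖z - d.zm‖

/-- Trial of `η` with one subsolver call; the stepsize condition holds at `z(η; z⁻)`. -/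
def Admissible (η : ℝ) : Prop := ∃ z, d.IsSolution η z ∧ d.StepCondition η z

/-- Trial of `η` with one subsolver call; the stepsize condition fails at `z(η; z⁻)`. -/
def Inadmissible (η : ℝ) : Prop := ∃ z, d.IsSolution η z ∧ ¬ d.StepCondition η z

/-- `res(z(η; z⁻)) ≤ ε`. -/
def Accurate (η : ℝ) : Prop :=
  ∃ z, d.IsSolution η z ∧ residual d.F d.H z ≤ ENNReal.ofReal d.ε

/-- `res(z(η; z⁻)) > ε`. -/
def Inaccurate (η : ℝ) : Prop :=
  ∃ z, d.IsSolution η z ∧ ENNReal.ofReal d.ε < residual d.F d.H z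

/-- `BacktrackLoop σ η ηup lo up`: the while-loop of Backtrack with initial stepsize `σ`, entered with
trial stepsize `η` and upper bound `ηup`, terminates and returns `(lo, up)`. -/
inductive BacktrackLoop (σ : ℝ) : ℝ → ℝ → ℝ → ℝ → Prop
  | exit {η ηup : ℝ} : d.Admissible η → BacktrackLoop σ η ηup η ηup
  | next {η ηup lo up : ℝ} : d.Inadmissible η →
      BacktrackLoop σ (d.β * η ^ 2 / σ) η lo up → BacktrackLoop σ η ηup lo up

/-- The subroutine Backtrack started from `σ` returns `(lo, up)`. -/
def Backtrack (σ lo up : ℝ) : Prop := d.BacktrackLoop σ (d.β * σ) σ lo up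

/-- `AdvanceLoop σ ηlo η lo up`: the while-loop of Advance with initial stepsize `σ`, entered with
lower bound `ηlo` and trial stepsize `η`, terminates and returns `(lo, up)`. -/
inductive AdvanceLoop (σ : ℝ) : ℝ → ℝ → ℝ → ℝ → Prop
  | exit_accurate {ηlo η : ℝ} : d.Accurate ηlo → AdvanceLoop σ ηlo η ηlo η
  | exit_inadmissible {ηlo η : ℝ} : d.Inadmissible η → AdvanceLoop σ ηlo η ηlo η
  | next {ηlo η lo up : ℝ} : d.Inaccurate ηlo → d.Admissible η →
      AdvanceLoop σ η (η ^ 2 / (d.β * σ)) lo up → AdvanceLoop σ ηlo η lo up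

/-- The subroutine Advance started from `σ` returns `(lo, up)`. -/
def Advance (σ lo up : ℝ) : Prop := d.AdvanceLoop σ σ (σ / d.β) lo up

/-- `Bisection ηlo ηup η`: the subroutine Bisection, entered with the interval `[ηlo, ηup]`,
terminates and returns `η`. -/
inductive Bisection : ℝ → ℝ → ℝ → Prop
  | exit {ηlo ηup : ℝ} : ηup / ηlo ≤ 1 / d.β → Bisection ηlo ηup ηlo
  | raise {ηlo ηup η : ℝ} : 1 / d.β < ηup / ηlo → d.Admissible √(ηlo * ηup) →
      Bisection √(ηlo * ηup) ηup η → Bisection ηlo ηup η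
  | lower {ηlo ηup η : ℝ} : 1 / d.β < ηup / ηlo → d.Inadmissible √(ηlo * ηup) →
      Bisection ηlo √(ηlo * ηup) η → Bisection ηlo ηup η

/-- `LineSearch σ η`: the line search with advancing, with initial trial stepsize `σ`, terminates and
returns the stepsize `η`. -/
inductive LineSearch (σ : ℝ) : ℝ → Prop
  | backtrack {lo up η : ℝ} : d.Inadmissible σ → d.Backtrack σ lo up → d.Bisection lo up η →
      LineSearch σ η
  | advance_accurate {lo up : ℝ} : d.Admissible σ → d.Advance σ lo up → d.Accurate lo →
      LineSearch σ lo
  | advance_bisect {lo up η : ℝ} : d.Admissible σ → d.Advance σ lo up → d.Inaccurate lo →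
      d.Bisection lo up η → LineSearch σ η

end LineSearchData

end LineSearch

/-! ### The `p`-th-order optimistic method -/

section Method

variable {V : Type*} [NormedAddCommGroup V] [NormedSpace ℝ V]

/-- The correction `v_k = η_{k-1} (F(z_k) - T_λ^{(p-1)}(z_k; z_{k-1}))`; it vanishes for `k = 0`, since
the prediction of `F(z_0)` is initialized as `F(z_0)` itself. -/
def correction (p : ℕ) (F : V → StrongDual ℝ V) (Φ : V → ℝ) (lam : ℝ) (z : ℕ → V) (η : ℕ → ℝ) :
    ℕ → StrongDual ℝ V
  | 0 => 0
  | k + 1 => η k • (F (z (k + 1)) - regTaylor p F Φ lam (z (k + 1)) (z k))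

/-- The initial trial stepsize of iteration `k`: `σ_0` is given and `σ_{k+1} = η_k / β`. -/
def trialStep (σ₀ β : ℝ) (η : ℕ → ℝ) : ℕ → ℝ
  | 0 => σ₀
  | k + 1 => η k / β

/-- The data of the line search in iteration `k`. -/
def iterData (p : ℕ) (F : V → StrongDual ℝ V) (H : V → Set (StrongDual ℝ V)) (Φ : V → ℝ)
    (lam α β ε : ℝ) (z : ℕ → V) (η : ℕ → ℝ) (k : ℕ) : LineSearchData V where
  F := F
  H := H
  Φ := Φ
  P := fun z' => regTaylor p F Φ lam z' (z k)
  v := correction p F Φ lam z η k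
  zm := z k
  α := α
  β := β
  ε := ε

/-- The first `N` iterations of the `p`-th-order optimistic method (with `η̂_k = η_{k-1}`), started at
`z 0` with trial stepsize `σ₀`, were carried out and produced the stepsizes `η 0, …, η (N - 1)` and
the iterates `z 1, …, z N`.  The method did not stop before: it returns `z_{k+1}` as soon as
`res(z_{k+1}) ≤ ε`. -/
structure IsMethodRun (p : ℕ) (F : V → StrongDual ℝ V) (H : V → Set (StrongDual ℝ V)) (Φ : V → ℝ)
    (lam σ₀ α β ε : ℝ) (N : ℕ) (z : ℕ → V) (η : ℕ → ℝ) : Prop where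
  lineSearch : ∀ k < N,
    (iterData p F H Φ lam α β ε z η k).LineSearch (trialStep σ₀ β η k) (η k)
  update : ∀ k < N, (iterData p F H Φ lam α β ε z η k).IsSolution (η k) (z (k + 1))
  not_stopped : ∀ k, k + 1 < N → ENNReal.ofReal ε < residual F H (z (k + 1))

/-- The averaged iterate `(∑_{k<N} η_k)⁻¹ ∑_{k<N} η_k z_{k+1}`. -/
def averaged (N : ℕ) (z : ℕ → V) (η : ℕ → ℝ) : V :=
  (∑ k ∈ Finset.range N, η k)⁻¹ • ∑ k ∈ Finset.range N, η k • z (k + 1)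

end Method

/-- `L_p(Φ, λ) = L_p + p L_Φ^{(p+1)/2} λ`. -/
def LpReg (p : ℕ) (Lp LΦ lam : ℝ) : ℝ :=
  Lp + p * LΦ ^ (((p : ℝ) + 1) / 2) * lam

/-- The constant `γ_p`. -/
def gammaP (p : ℕ) (LΦ α β : ℝ) : ℝ :=
  √(2 / (1 - α)) * LΦ ^ ((3 : ℝ) / 2) * (2 / ((p ! : ℝ) * α * β ^ p)) ^ (1 / ((p : ℝ) - 1)) +
    1 / √(2 * (1 - α)) * (2 / ((p ! : ℝ) * α * β ^ p)) ^ (1 / ((p : ℝ) - 1)) *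
      α * (β + LΦ ^ ((1 : ℝ) / 2))

/-! ### The saddle point problem

The product `E × G` with the norm `√(‖x‖² + ‖y‖²)` is `WithLp 2 (E × G)`. -/

section Saddle

variable {E G : Type*} [NormedAddCommGroup E] [NormedSpace ℝ E]
  [NormedAddCommGroup G] [NormedSpace ℝ G]

/-- The feasible set `X × Y`. -/
def feasible (X : Set E) (Y : Set G) : Set (WithLp 2 (E × G)) :=
  {z | z.fst ∈ X ∧ z.snd ∈ Y}

/-- The functional on the product with components `a` and `b`, i.e. `(x, y) ↦ ⟨a, x⟩ + ⟨b, y⟩`. -/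
def pairDual (a : StrongDual ℝ E) (b : StrongDual ℝ G) : StrongDual ℝ (WithLp 2 (E × G)) :=
  a.comp (WithLp.fstL 2 ℝ E G) + b.comp (WithLp.sndL 2 ℝ E G)

/-- The partial gradient `∇ₓ f(x, y)` of a differentiable function. -/
def gradX (f : WithLp 2 (E × G) → ℝ) (z : WithLp 2 (E × G)) : StrongDual ℝ E :=
  ((fderiv ℝ f z).comp ((WithLp.prodContinuousLinearEquiv 2 ℝ E G).symm :
    E × G →L[ℝ] WithLp 2 (E × G))).comp (ContinuousLinearMap.inl ℝ E G)

/-- The partial gradient `∇_y f(x, y)` of a differentiable function. -/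
def gradY (f : WithLp 2 (E × G) → ℝ) (z : WithLp 2 (E × G)) : StrongDual ℝ G :=
  ((fderiv ℝ f z).comp ((WithLp.prodContinuousLinearEquiv 2 ℝ E G).symm :
    E × G →L[ℝ] WithLp 2 (E × G))).comp (ContinuousLinearMap.inr ℝ E G)

/-- The operator `F(z) = (∇ₓ f(x, y), -∇_y f(x, y))`. -/
def saddleF (f : WithLp 2 (E × G) → ℝ) (z : WithLp 2 (E × G)) :
    StrongDual ℝ (WithLp 2 (E × G)) :=
  pairDual (gradX f z) (-gradY f z)

/-- The set-valued operator `H(z) = (∂h₁(x) + N_X(x)) × (∂h₂(y) + N_Y(y))`. -/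
def saddleH (X : Set E) (Y : Set G) (h₁ : E → EReal) (h₂ : G → EReal) (z : WithLp 2 (E × G)) :
    Set (StrongDual ℝ (WithLp 2 (E × G))) :=
  {w | ∃ a ∈ subdifferential h₁ z.fst, ∃ m ∈ normalCone X z.fst,
    ∃ b ∈ subdifferential h₂ z.snd, ∃ n ∈ normalCone Y z.snd, w = pairDual (a + m) (b + n)}

/-- The objective `ℓ(x, y) = f(x, y) + h₁(x) - h₂(y)`. -/
def objective (f : WithLp 2 (E × G) → ℝ) (h₁ : E → EReal) (h₂ : G → EReal) (x : E) (y : G) :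
    EReal :=
  ((f (toLp 2 (x, y)) : ℝ) : EReal) + h₁ x - h₂ y

/-- The mirror map `Φ(x, y) = Φ_X(x) + Φ_Y(y)` of the product. -/
def mirror (ΦX : E → ℝ) (ΦY : G → ℝ) (z : WithLp 2 (E × G)) : ℝ := ΦX z.fst + ΦY z.snd

/-- `f` is convex in `x` and concave in `y` on `X × Y`. -/
def IsConvexConcaveOn (f : WithLp 2 (E × G) → ℝ) (X : Set E) (Y : Set G) : Prop :=
  (∀ y ∈ Y, ConvexOn ℝ X fun x => f (toLp 2 (x, y))) ∧
    ∀ x ∈ X, ConcaveOn ℝ Y fun y => f (toLp 2 (x, y))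

/-- `z` is a saddle point of `min_{x ∈ X} max_{y ∈ Y} ℓ(x, y)` (with a finite saddle value). -/
structure IsSaddlePoint (f : WithLp 2 (E × G) → ℝ) (X : Set E) (Y : Set G)
    (h₁ : E → EReal) (h₂ : G → EReal) (z : WithLp 2 (E × G)) : Prop where
  mem : z ∈ feasible X Y
  finite_fst : h₁ z.fst ≠ ⊤
  finite_snd : h₂ z.snd ≠ ⊤
  max_snd : ∀ y ∈ Y, objective f h₁ h₂ z.fst y ≤ objective f h₁ h₂ z.fst z.snd
  min_fst : ∀ x ∈ X, objective f h₁ h₂ z.fst z.snd ≤ objective f h₁ h₂ x z.snd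

end Saddle

end

end HighOrderOptimistic

/-!
The method is an optimistic (past-extragradient) proximal scheme, and its analysis rests on three
facts.

*The subproblems are well posed.* The error of the Taylor expansion of `F` has derivative at most
`L_p / (p - 1)! ‖w - z‖ ^ (p - 1)` at `w` (`norm_fderiv_sub_taylorPoly_le`). For `λ ≥ L_p` the
regularization compensates the resulting loss of monotonicity. As `Φ` is only once differentiable,
this is not seen from second derivatives: the segment between two points is split at the point
closest to the base point in the Bregman distance, and on each part the Bregman distance is
largest at the far end (`regTaylor_monotone`). Hence the solution for a given stepsize is unique,
and solutions for different stepsizes are comparable (`IsMonotoneOn.sq_norm_sub_le`). Uniqueness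
makes the line search deterministic: it returns an admissible stepsize, next to an inadmissible
one at most `1 / β` times as large unless the accuracy is reached (`LineSearch.spec`).

*Energy.* Let `D_k` be the Bregman distance from `z_k` to a point `u`. For each step,
`η_k ⟨F(z_{k+1}) + w_{k+1}, z_{k+1} - u⟩` equals a telescoping term in the corrections, plus
`D_k - D_{k+1}`, minus the Bregman length of the step, minus the pairing of the correction `v_k`
with the step. Admissibility bounds `v_k` by the previous step, and so this pairing by `α / 4`
times the sum of the squares of two consecutive steps (`IsMethodRun.energy_inequality`). At a
saddle point the weighted sum on the left is nonnegative, which bounds `D_k` and the sum of the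
squared steps; at any other point it dominates the gap of the average, by Jensen's inequality.

*Large stepsizes.* An inadmissible stepsize is at least a constant times the distance between its
solution and `z_k` to the power `-(p - 1)`, since the regularized Taylor expansion is accurate to
order `p` (`norm_sub_regTaylor_le`). The comparison of solutions replaces that distance by the
lengths of the last two steps (`IsMethodRun.one_le_stepsize`), whose squares are summable, and
Hölder's inequality turns this into growth of the sum of the stepsizes like `N ^ ((p + 1) / 2)`
(`inv_sum_le_of_one_le_mul_pow`).
-/

namespace HighOrderOptimistic

noncomputable section

/-! ### Taylor expansions along a convex set -/

section Taylor

universe u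

variable {V W : Type u} [NormedAddCommGroup V] [NormedSpace ℝ V]
  [NormedAddCommGroup W] [NormedSpace ℝ W]

/-- The `q`-th-order Taylor polynomial of `F : V → W` at `z`, evaluated at `w`.  For dual-valued `F`
this is `taylorExp`; a general codomain is needed because the induction on the order passes from `F`
to `fderiv ℝ F`.  The two spaces share a universe so that `V →L[ℝ] W` stays in it. -/
def taylorPoly (q : ℕ) (F : V → W) (w z : V) : W :=
  ∑ i ∈ Finset.range (q + 1), (1 / (i ! : ℝ)) • iteratedFDeriv ℝ i F z (fun _ => w - z)

theorem taylorPoly_self (q : ℕ) (F : V → W) (z : V) : taylorPoly q F z z = F z := by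
  rw [taylorPoly, Finset.sum_range_succ']
  simp only [sub_self]
  rw [Finset.sum_eq_zero]
  · simp
  · intro i _
    rw [(iteratedFDeriv ℝ (i + 1) F z).map_coord_zero (0 : Fin (i + 1)) rfl, smul_zero]

/-- The derivatives of the second derivative are symmetric in the last two arguments, because the
second derivative is symmetric near the base point. -/
theorem iteratedFDeriv_fderiv_fderiv_comm {n : ℕ} {F : V → W} {z : V}
    (hF : ContDiffAt ℝ (n + 2 : ℕ) F z) (m : Fin n → V) (h k : V) :
    iteratedFDeriv ℝ n (fderiv ℝ (fderiv ℝ F)) z m h k =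
      iteratedFDeriv ℝ n (fderiv ℝ (fderiv ℝ F)) z m k h := by
  have hn : ((n + 2 : ℕ) : WithTop ℕ∞) ≠ ((⊤ : ℕ∞) : WithTop ℕ∞) := by
    intro h
    exact ENat.natCast_ne_top (n + 2) (WithTop.coe_injective h)
  have hsymm : (ContinuousLinearMap.flipₗᵢ ℝ V V W) ∘ fderiv ℝ (fderiv ℝ F) =ᶠ[nhds z]
      fderiv ℝ (fderiv ℝ F) := by
    filter_upwards [hF.eventually hn] with x hx
    ext a b
    exact (hx.isSymmSndFDerivAt (by simp)) b a
  have hC : ContDiffAt ℝ n (fderiv ℝ (fderiv ℝ F)) z :=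
    (hF.fderiv_right (m := (n + 1 : ℕ)) (by norm_cast)).fderiv_right (by norm_cast)
  have hcomp := ContinuousLinearMap.iteratedFDeriv_comp_left (F := V →L[ℝ] V →L[ℝ] W)
    (G := V →L[ℝ] V →L[ℝ] W)
    (ContinuousLinearMap.flipₗᵢ ℝ V V W).toContinuousLinearEquiv.toContinuousLinearMap hC le_rfl
  have hcomp' := (hsymm.iteratedFDeriv ℝ n).eq_of_nhds.symm.trans hcomp
  conv_lhs => rw [hcomp']
  rfl

/-- Inserting one direction `h` among equal arguments `v` of an iterated derivative amounts to the
iterated derivative of `fderiv ℝ F`, evaluated at `h`, whatever the slot. -/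
theorem iteratedFDeriv_succ_update {n : ℕ} {F : V → W} {z : V} (hF : ContDiffAt ℝ (n + 1 : ℕ) F z)
    (v h : V) (j : Fin (n + 1)) :
    iteratedFDeriv ℝ (n + 1) F z (Function.update (fun _ => v) j h) =
      iteratedFDeriv ℝ n (fderiv ℝ F) z (fun _ => v) h := by
  induction n generalizing W with
  | zero =>
    rw [iteratedFDeriv_succ_apply_right, Fin.fin_one_eq_zero j, ← Fin.last_zero,
      Function.update_self]
    congr 2
    exact Subsingleton.elim _ _
  | succ n ih =>
    rw [iteratedFDeriv_succ_apply_right]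
    induction j using Fin.lastCases with
    | last =>
      rw [Function.update_self]
      congr 2
      ext i
      simp [Fin.init, (Fin.castSucc_lt_last i).ne]
    | cast i =>
      have hinit : Fin.init (Function.update (fun _ : Fin (n + 2) => v) i.castSucc h) =
          Function.update (fun _ => v) i h := by
        ext l
        simp [Fin.init, Function.update_apply]
      have hlast :
          Function.update (fun _ : Fin (n + 2) => v) i.castSucc h (Fin.last (n + 1)) = v := by
        simp [(Fin.castSucc_lt_last i).ne']
      rw [hinit, hlast, ih (hF.fderiv_right (by norm_cast)), iteratedFDeriv_succ_apply_right]
      exact iteratedFDeriv_fderiv_fderiv_comm hF _ _ _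

/-- The derivative of the Taylor polynomial of `F` is the Taylor polynomial, of one order less, of
the derivative of `F`; this rests on the symmetry of the iterated derivatives. -/
theorem hasFDerivAt_taylorPoly_succ {q : ℕ} {F : V → W} {z : V}
    (hF : ContDiffAt ℝ (q + 1 : ℕ) F z) (w : V) :
    HasFDerivAt (fun w => taylorPoly (q + 1) F w z) (taylorPoly q (fderiv ℝ F) w z) w := by
  have hterm : ∀ i ∈ Finset.range (q + 1),
      HasFDerivAt (fun w => (1 / ((i + 1)! : ℝ)) • iteratedFDeriv ℝ (i + 1) F z (fun _ => w - z))
        ((1 / (i ! : ℝ)) • iteratedFDeriv ℝ i (fderiv ℝ F) z (fun _ => w - z)) w := by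
    intro i hi
    have hi' : i + 1 ≤ q + 1 := by simpa [Nat.lt_succ_iff] using hi
    have hFi : ContDiffAt ℝ (i + 1 : ℕ) F z := hF.of_le (by exact_mod_cast hi')
    have hdiag : HasFDerivAt (fun w : V => fun _ : Fin (i + 1) => w - z)
        (ContinuousLinearMap.pi fun _ => ContinuousLinearMap.id ℝ V) w :=
      hasFDerivAt_pi.2 fun _ => (hasFDerivAt_id w).sub_const z
    have h := (((iteratedFDeriv ℝ (i + 1) F z).hasFDerivAt
      (fun _ => w - z)).comp w hdiag).const_smul (1 / ((i + 1)! : ℝ))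
    refine h.congr_fderiv ?_
    ext k
    simp only [smul_apply, ContinuousLinearMap.comp_apply,
      ContinuousMultilinearMap.linearDeriv_apply, ContinuousLinearMap.coe_pi',
      ContinuousLinearMap.id_apply, iteratedFDeriv_succ_update hFi]
    rw [Finset.sum_const, Finset.card_univ, Fintype.card_fin, ← Nat.cast_smul_eq_nsmul ℝ, smul_smul]
    congr 1
    rw [Nat.factorial_succ]
    have : ((i ! : ℕ) : ℝ) ≠ 0 := by positivity
    push_cast
    field_simp
  have h := (HasFDerivAt.fun_sum hterm).add_const
    ((1 / (0 ! : ℝ)) • iteratedFDeriv ℝ 0 F z (fun _ => w - z))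
  have hfun : (fun w => taylorPoly (q + 1) F w z) = fun w' =>
      ∑ i ∈ Finset.range (q + 1),
          (1 / ((i + 1)! : ℝ)) • iteratedFDeriv ℝ (i + 1) F z (fun _ => w' - z)
        + (1 / (0 ! : ℝ)) • iteratedFDeriv ℝ 0 F z (fun _ => w - z) := by
    funext w'
    rw [taylorPoly, Finset.sum_range_succ']
    simp
  rw [hfun]
  exact h

theorem norm_iteratedFDeriv_fderiv_sub (n : ℕ) (F : V → W) (a b : V) :
    ‖iteratedFDeriv ℝ n (fderiv ℝ F) a - iteratedFDeriv ℝ n (fderiv ℝ F) b‖ =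
      ‖iteratedFDeriv ℝ (n + 1) F a - iteratedFDeriv ℝ (n + 1) F b‖ := by
  simp only [iteratedFDeriv_succ_eq_comp_right, Function.comp_apply]
  exact ((continuousMultilinearCurryRightEquiv' ℝ n V W).symm.map_sub _ _).symm ▸
    LinearIsometryEquiv.norm_map _ _ |>.symm

theorem norm_sub_taylorPoly_zero_le {F : V → W} {z w : V} {L : ℝ}
    (h : ‖iteratedFDeriv ℝ 0 F w - iteratedFDeriv ℝ 0 F z‖ ≤ L * ‖w - z‖) :
    ‖F w - taylorPoly 0 F w z‖ ≤ L * ‖w - z‖ := by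
  simp only [iteratedFDeriv_zero_eq_comp, Function.comp_apply] at h
  rw [← map_sub, LinearIsometryEquiv.norm_map] at h
  simpa [taylorPoly] using h

/-- Taylor's theorem on a convex set, for a function whose `q`-th derivative is Lipschitz there. -/
theorem norm_sub_taylorPoly_le {U Z : Set V} (hU : IsOpen U) (hZU : Z ⊆ U) (hZ : Convex ℝ Z)
    {L : ℝ} (q : ℕ) {F : V → W} (hF : ContDiffOn ℝ q F U)
    (hL : ∀ a ∈ Z, ∀ b ∈ Z, ‖iteratedFDeriv ℝ q F a - iteratedFDeriv ℝ q F b‖ ≤ L * ‖a - b‖)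
    {z w : V} (hz : z ∈ Z) (hw : w ∈ Z) :
    ‖F w - taylorPoly q F w z‖ ≤ L / ((q + 1)! : ℝ) * ‖w - z‖ ^ (q + 1) := by
  induction q generalizing W w with
  | zero => simpa using norm_sub_taylorPoly_zero_le (hL w hw z hz)
  | succ q ih =>
    have hF' : ContDiffOn ℝ q (fderiv ℝ F) U := hF.fderiv_of_isOpen hU (by norm_cast)
    have hL' : ∀ a ∈ Z, ∀ b ∈ Z, ‖iteratedFDeriv ℝ q (fderiv ℝ F) a -
        iteratedFDeriv ℝ q (fderiv ℝ F) b‖ ≤ L * ‖a - b‖ := fun a ha b hb => by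
      rw [norm_iteratedFDeriv_fderiv_sub]; exact hL a ha b hb
    have hrem := fun {x : V} (hx : x ∈ Z) => ih hF' hL' hx
    have hseg : ∀ t ∈ Icc (0 : ℝ) 1, z + t • (w - z) ∈ Z := fun t ht =>
      hZ.add_smul_sub_mem hz hw ht
    have hFz : ContDiffAt ℝ (q + 1 : ℕ) F z := hF.contDiffAt (hU.mem_nhds (hZU hz))
    have hR : ∀ t ∈ Icc (0 : ℝ) 1, HasDerivAt
        (fun t : ℝ => F (z + t • (w - z)) - taylorPoly (q + 1) F (z + t • (w - z)) z)
        ((fderiv ℝ F (z + t • (w - z)) - taylorPoly q (fderiv ℝ F) (z + t • (w - z)) z) (w - z))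
        t := by
      intro t ht
      have hline : HasDerivAt (fun t : ℝ => z + t • (w - z)) (w - z) t := by
        simpa using ((hasDerivAt_id t).smul_const (w - z)).const_add z
      have hFt : HasFDerivAt F (fderiv ℝ F (z + t • (w - z))) (z + t • (w - z)) :=
        (((hF.contDiffAt (hU.mem_nhds (hZU (hseg t ht)))).differentiableAt
          (by simp))).hasFDerivAt
      exact HasFDerivAt.comp_hasDerivAt t (hFt.sub (hasFDerivAt_taylorPoly_succ hFz _)) hline
    have hB : ∀ t : ℝ, HasDerivAt
        (fun t : ℝ => L / ((q + 1 + 1)! : ℝ) * ‖w - z‖ ^ (q + 1 + 1) * t ^ (q + 1 + 1))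
        (L / ((q + 1)! : ℝ) * ‖w - z‖ ^ (q + 1 + 1) * t ^ (q + 1)) t := by
      intro t
      have h := (hasDerivAt_pow (q + 1 + 1) t).const_mul
        (L / ((q + 1 + 1)! : ℝ) * ‖w - z‖ ^ (q + 1 + 1))
      refine h.congr_deriv ?_
      rw [Nat.factorial_succ (q + 1)]
      have : (((q + 1)! : ℕ) : ℝ) ≠ 0 := by positivity
      push_cast
      field_simp
    have key := image_norm_le_of_norm_deriv_right_le_deriv_boundary (a := 0) (b := 1)
      (fun t ht => (hR t ht).continuousAt.continuousWithinAt)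
      (fun t ht => (hR t (Ico_subset_Icc_self ht)).hasDerivWithinAt)
      (B := fun t : ℝ => L / ((q + 1 + 1)! : ℝ) * ‖w - z‖ ^ (q + 1 + 1) * t ^ (q + 1 + 1))
      (by simp [taylorPoly_self]) hB ?_ (right_mem_Icc.2 zero_le_one)
    · simpa using key
    · intro t ht
      refine (ContinuousLinearMap.le_opNorm _ _).trans ?_
      have h1 := hrem (hseg t (Ico_subset_Icc_self ht))
      rw [add_sub_cancel_left, norm_smul, Real.norm_of_nonneg ht.1, mul_pow] at h1
      calc _ ≤ L / ((q + 1)! : ℝ) * (t ^ (q + 1) * ‖w - z‖ ^ (q + 1)) * ‖w - z‖ := by gcongr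
        _ = _ := by ring

theorem norm_fderiv_sub_taylorPoly_le {U Z : Set V} (hU : IsOpen U) (hZU : Z ⊆ U)
    (hZ : Convex ℝ Z) {L : ℝ} {q : ℕ} {F : V → W} (hF : ContDiffOn ℝ (q + 1 : ℕ) F U)
    (hL : ∀ a ∈ Z, ∀ b ∈ Z,
      ‖iteratedFDeriv ℝ (q + 1) F a - iteratedFDeriv ℝ (q + 1) F b‖ ≤ L * ‖a - b‖)
    {z w : V} (hz : z ∈ Z) (hw : w ∈ Z) :
    ‖fderiv ℝ F w - taylorPoly q (fderiv ℝ F) w z‖ ≤ L / ((q + 1)! : ℝ) * ‖w - z‖ ^ (q + 1) :=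
  norm_sub_taylorPoly_le hU hZU hZ q (hF.fderiv_of_isOpen hU (by norm_cast))
    (fun a ha b hb => by rw [norm_iteratedFDeriv_fderiv_sub]; exact hL a ha b hb) hz hw

end Taylor

/-! ### Bregman distances -/

section Bregman

variable {V : Type*} [NormedAddCommGroup V] [NormedSpace ℝ V] {Φ : V → ℝ} {Z : Set V} {L : ℝ}

theorem fderiv_sub_fderiv_apply_sub (Φ : V → ℝ) (a b c : V) :
    (fderiv ℝ Φ a - fderiv ℝ Φ b) (a - c) =
      bregman Φ c a + bregman Φ a b - bregman Φ c b := by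
  simp only [bregman, sub_apply, map_sub]
  ring

theorem IsMirrorMapOn.half_sq_le_bregman (hΦ : IsMirrorMapOn Φ Z) {a b : V} (ha : a ∈ Z)
    (hb : b ∈ Z) : ‖a - b‖ ^ 2 / 2 ≤ bregman Φ a b := by
  have := hΦ.2 b hb a ha
  rw [bregman]
  linarith

theorem IsMirrorMapOn.bregman_nonneg (hΦ : IsMirrorMapOn Φ Z) {a b : V} (ha : a ∈ Z)
    (hb : b ∈ Z) : 0 ≤ bregman Φ a b :=
  le_trans (by positivity) (hΦ.half_sq_le_bregman ha hb)

theorem IsMirrorMapOn.sq_norm_le (hΦ : IsMirrorMapOn Φ Z) {a b : V} (ha : a ∈ Z) (hb : b ∈ Z) :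
    ‖a - b‖ ^ 2 ≤ (fderiv ℝ Φ a - fderiv ℝ Φ b) (a - b) := by
  have h1 := hΦ.half_sq_le_bregman ha hb
  have h2 := hΦ.half_sq_le_bregman hb ha
  have h3 := fderiv_sub_fderiv_apply_sub Φ a b b
  rw [norm_sub_rev] at h2
  have : bregman Φ b b = 0 := by simp [bregman]
  linarith

theorem one_le_of_isGradLipschitzOn (hΦ : IsMirrorMapOn Φ Z) (hL : IsGradLipschitzOn Φ L Z)
    {a b : V} (ha : a ∈ Z) (hb : b ∈ Z) (hab : a ≠ b) : 1 ≤ L := by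
  have hpos : 0 < ‖a - b‖ := norm_pos_iff.2 (sub_ne_zero.2 hab)
  have h1 := hΦ.sq_norm_le ha hb
  have h2 := (le_abs_self _).trans ((fderiv ℝ Φ a - fderiv ℝ Φ b).le_opNorm (a - b))
  have h3 := mul_le_mul_of_nonneg_right (hL.2 a ha b hb) hpos.le
  have h4 : 1 * ‖a - b‖ ^ 2 ≤ L * ‖a - b‖ ^ 2 := by nlinarith
  exact le_of_mul_le_mul_right h4 (by positivity)

theorem IsMirrorMapOn.hasFDerivAt_bregman (hΦ : IsMirrorMapOn Φ Z) (z : V) {w : V} (hw : w ∈ Z) :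
    HasFDerivAt (fun w => bregman Φ w z) (fderiv ℝ Φ w - fderiv ℝ Φ z) w := by
  have h := ((hΦ.1 w hw).hasFDerivAt.sub_const (Φ z)).sub
    ((fderiv ℝ Φ z).hasFDerivAt.comp w ((hasFDerivAt_id w).sub_const z))
  exact h

theorem IsMirrorMapOn.bregman_add_le (hΦ : IsMirrorMapOn Φ Z) (z : V) {w w' : V} (hw : w ∈ Z)
    (hw' : w' ∈ Z) :
    bregman Φ w z + (fderiv ℝ Φ w - fderiv ℝ Φ z) (w' - w) ≤ bregman Φ w' z := by
  have h := hΦ.bregman_nonneg hw' hw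
  simp only [bregman, sub_apply, map_sub] at h ⊢
  linarith

theorem IsMirrorMapOn.convexOn_bregman (hΦ : IsMirrorMapOn Φ Z) (hZ : Convex ℝ Z) (z : V) :
    ConvexOn ℝ Z fun w => bregman Φ w z := by
  refine ⟨hZ, fun a ha b hb s t hs ht hst => ?_⟩
  have hw := hZ ha hb hs ht hst
  set w := s • a + t • b with hwdef
  have h1 := mul_le_mul_of_nonneg_left (hΦ.bregman_add_le z hw ha) hs
  have h2 := mul_le_mul_of_nonneg_left (hΦ.bregman_add_le z hw hb) ht
  have h0 : s • (a - w) + t • (b - w) = 0 := by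
    rw [smul_sub, smul_sub, sub_add_sub_comm, ← add_smul, hst, one_smul, sub_self]
  have h3 := congrArg (fderiv ℝ Φ w - fderiv ℝ Φ z) h0
  rw [map_add, map_smul, map_smul, map_zero, smul_eq_mul, smul_eq_mul] at h3
  have h4 : s * bregman Φ w z + t * bregman Φ w z = bregman Φ w z := by
    rw [← add_mul, hst, one_mul]
  simp only [smul_eq_mul]
  linarith

theorem bregman_le_of_isGradLipschitzOn (hΦ : IsMirrorMapOn Φ Z) (hL : IsGradLipschitzOn Φ L Z)
    (hZ : Convex ℝ Z) {a b : V} (ha : a ∈ Z) (hb : b ∈ Z) :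
    2 * bregman Φ a b ≤ L * ‖a - b‖ ^ 2 := by
  have hseg : ∀ t ∈ Icc (0 : ℝ) 1, b + t • (a - b) ∈ Z := fun t ht =>
    hZ.add_smul_sub_mem hb ha ht
  have hR : ∀ t ∈ Icc (0 : ℝ) 1, HasDerivAt (fun t : ℝ => bregman Φ (b + t • (a - b)) b)
      ((fderiv ℝ Φ (b + t • (a - b)) - fderiv ℝ Φ b) (a - b)) t := by
    intro t ht
    have hline : HasDerivAt (fun t : ℝ => b + t • (a - b)) (a - b) t := by
      simpa using ((hasDerivAt_id t).smul_const (a - b)).const_add b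
    exact HasFDerivAt.comp_hasDerivAt t (hΦ.hasFDerivAt_bregman b (hseg t ht)) hline
  have hB : ∀ t : ℝ, HasDerivAt (fun t : ℝ => L / 2 * ‖a - b‖ ^ 2 * t ^ 2)
      (L * ‖a - b‖ ^ 2 * t) t := by
    intro t
    refine ((hasDerivAt_pow 2 t).const_mul (L / 2 * ‖a - b‖ ^ 2)).congr_deriv ?_
    simp
    ring
  have key := image_norm_le_of_norm_deriv_right_le_deriv_boundary (a := 0) (b := 1)
    (fun t ht => (hR t ht).continuousAt.continuousWithinAt)
    (fun t ht => (hR t (Ico_subset_Icc_self ht)).hasDerivWithinAt)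
    (B := fun t : ℝ => L / 2 * ‖a - b‖ ^ 2 * t ^ 2) (by simp [bregman]) hB ?_
    (right_mem_Icc.2 zero_le_one)
  · have h := (le_abs_self _).trans key
    simp only [one_smul, add_sub_cancel] at h
    linarith
  · intro t ht
    refine (ContinuousLinearMap.le_opNorm _ _).trans ?_
    have h1 := hL.2 _ (hseg t (Ico_subset_Icc_self ht)) b hb
    rw [add_sub_cancel_left, norm_smul, Real.norm_of_nonneg ht.1] at h1
    calc _ ≤ L * (t * ‖a - b‖) * ‖a - b‖ := by gcongr
      _ = _ := by ring

end Bregman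

/-! ### The regularized Taylor expansion -/

section RegTaylor

variable {V : Type*} [NormedAddCommGroup V] [NormedSpace ℝ V] {Φ : V → ℝ} {Z U : Set V}
  {LΦ Lp lam : ℝ} {F : V → StrongDual ℝ V} {p : ℕ}

theorem sq_rpow_half_sub_one (hp : 1 ≤ p) {x : ℝ} (hx : 0 ≤ x) :
    (x ^ 2) ^ (((p : ℝ) - 1) / 2) = x ^ (p - 1) := by
  rw [← Real.rpow_natCast x 2, ← Real.rpow_mul hx, ← Real.rpow_natCast x (p - 1)]
  congr 1
  push_cast [Nat.cast_sub hp]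
  ring

theorem IsMirrorMapOn.pow_norm_le_rpow_bregman (hΦ : IsMirrorMapOn Φ Z) (hp : 1 ≤ p) {w z : V}
    (hw : w ∈ Z) (hz : z ∈ Z) :
    ‖w - z‖ ^ (p - 1) ≤ (2 * bregman Φ w z) ^ (((p : ℝ) - 1) / 2) := by
  rw [← sq_rpow_half_sub_one hp (norm_nonneg _)]
  have hp' : (1 : ℝ) ≤ p := by exact_mod_cast hp
  have := hΦ.half_sq_le_bregman hw hz
  exact Real.rpow_le_rpow (by positivity) (by linarith) (by linarith)

/-- Monotonicity of the regularized Taylor expansion between two points `c`, `a` when the distance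
to the base point `z` is smallest at `c` on the segment. The power of the Bregman distance is then
largest at `a`, where it dominates the error of the Taylor expansion of `F'` on the whole segment. -/
theorem regTaylor_monotone_of_isMinOn (hU : IsOpen U) (hZU : Z ⊆ U) (hZ : Convex ℝ Z) (hp : 2 ≤ p)
    (hF : ContDiffOn ℝ (p - 1 : ℕ) F U) (hLp : IsHighOrderSmoothOn p F Lp Z)
    (hmono : ∀ a ∈ Z, ∀ b ∈ Z, 0 ≤ (F a - F b) (a - b))
    (hΦ : IsMirrorMapOn Φ Z) (hlam : Lp ≤ lam) {a c z : V} (ha : a ∈ Z) (hc : c ∈ Z) (hz : z ∈ Z)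
    (hmin : IsMinOn (fun w => bregman Φ w z) (segment ℝ c a) c) :
    0 ≤ (regTaylor p F Φ lam a z - regTaylor p F Φ lam c z) (a - c) := by
  obtain ⟨q, rfl⟩ : ∃ q, p = q + 2 := ⟨p - 2, by omega⟩
  have hsegZ : segment ℝ c a ⊆ Z := hZ.segment_subset hc ha
  have hexp : (0 : ℝ) ≤ (((q + 2 : ℕ) : ℝ) - 1) / 2 := by
    have : (0 : ℝ) ≤ q := Nat.cast_nonneg q
    push_cast
    linarith
  set g : V → ℝ := fun w => (2 * bregman Φ w z) ^ ((((q + 2 : ℕ) : ℝ) - 1) / 2) with hg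
  have hLp0 : 0 ≤ Lp := hLp.1
  have hmax : ∀ w ∈ segment ℝ c a, bregman Φ w z ≤ bregman Φ a z := fun w hw =>
    ((hΦ.convexOn_bregman hZ z).le_on_segment hc ha hw).trans
      (max_le (hmin (right_mem_segment ℝ c a)) le_rfl)
  have hgmax : ∀ w ∈ segment ℝ c a, g w ≤ g a := fun w hw =>
    Real.rpow_le_rpow (mul_nonneg zero_le_two (hΦ.bregman_nonneg (hsegZ hw) hz))
      (mul_le_mul_of_nonneg_left (hmax w hw) zero_le_two) hexp
  -- the error of the Taylor expansion is Lipschitz on the segment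
  have herr : ‖(F a - taylorPoly (q + 1) F a z) - (F c - taylorPoly (q + 1) F c z)‖ ≤
      Lp / ((q + 1)! : ℝ) * g a * ‖a - c‖ := by
    refine Convex.norm_image_sub_le_of_norm_hasFDerivWithin_le
      (f := fun w => F w - taylorPoly (q + 1) F w z)
      (f' := fun w => fderiv ℝ F w - taylorPoly q (fderiv ℝ F) w z)
      (s := segment ℝ c a) (fun w hw => ?_) (fun w hw => ?_) (convex_segment c a)
      (left_mem_segment ℝ c a) (right_mem_segment ℝ c a)
    · have hFw : DifferentiableAt ℝ F w :=
        (hF.contDiffAt (hU.mem_nhds (hZU (hsegZ hw)))).differentiableAt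
          (by exact_mod_cast (by omega : q + 2 - 1 ≠ 0))
      exact (hFw.hasFDerivAt.sub (hasFDerivAt_taylorPoly_succ
        (hF.contDiffAt (hU.mem_nhds (hZU hz))) w)).hasFDerivWithinAt
    · refine (norm_fderiv_sub_taylorPoly_le hU hZU hZ hF hLp.2 hz (hsegZ hw)).trans ?_
      gcongr
      exact (hΦ.pow_norm_le_rpow_bregman (p := q + 2) (by omega) (hsegZ hw) hz).trans (hgmax w hw)
  have h1 : (F a - taylorPoly (q + 1) F a z - (F c - taylorPoly (q + 1) F c z)) (a - c) ≤
      Lp / ((q + 1)! : ℝ) * g a * ‖a - c‖ * ‖a - c‖ :=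
    (le_abs_self _).trans (ContinuousLinearMap.le_of_opNorm_le _ herr _)
  have h2 := hmono a ha c hc
  -- first-order optimality of `c`
  have hopt : 0 ≤ (fderiv ℝ Φ c - fderiv ℝ Φ z) (a - c) :=
    hmin.localize.hasFDerivWithinAt_nonneg (hΦ.hasFDerivAt_bregman z hc).hasFDerivWithinAt
      (sub_mem_posTangentConeAt_of_segment_subset subset_rfl)
  have hga : 0 ≤ g a := Real.rpow_nonneg (mul_nonneg zero_le_two (hΦ.bregman_nonneg ha hz)) _
  have hgc : g c ≤ g a := hgmax c (left_mem_segment ℝ c a)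
  have hstrong := hΦ.sq_norm_le ha hc
  have h3 : g a * ‖a - c‖ ^ 2 ≤
      g a * (fderiv ℝ Φ a - fderiv ℝ Φ z) (a - c) -
        g c * (fderiv ℝ Φ c - fderiv ℝ Φ z) (a - c) := by
    have e1 := mul_le_mul_of_nonneg_left hstrong hga
    have e2 := mul_nonneg (sub_nonneg.2 hgc) hopt
    have e3 : (fderiv ℝ Φ a - fderiv ℝ Φ c) (a - c) = (fderiv ℝ Φ a - fderiv ℝ Φ z) (a - c) -
        (fderiv ℝ Φ c - fderiv ℝ Φ z) (a - c) := by
      simp only [sub_apply]; ring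
    rw [e3] at e1
    linarith
  have hK : 0 ≤ lam / ((q + 1)! : ℝ) := div_nonneg (hLp0.trans hlam) (by positivity)
  have h4 := mul_le_mul_of_nonneg_left h3 hK
  have h5 : Lp / ((q + 1)! : ℝ) * (g a * ‖a - c‖ ^ 2) ≤
      lam / ((q + 1)! : ℝ) * (g a * ‖a - c‖ ^ 2) := by gcongr
  have hreg : ∀ w, regTaylor (q + 2) F Φ lam w z = taylorPoly (q + 1) F w z +
      (lam / ((q + 1)! : ℝ) * g w) • (fderiv ℝ Φ w - fderiv ℝ Φ z) := fun w => rfl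
  rw [hreg, hreg]
  simp only [sub_apply, add_apply, smul_apply, smul_eq_mul] at h1 h2 h4 ⊢
  linarith

/-- For `λ ≥ L_p` the regularized Taylor expansion of a monotone operator is monotone: split the
segment at the point closest to the base point in the Bregman distance. -/
theorem regTaylor_monotone (hU : IsOpen U) (hZU : Z ⊆ U) (hZ : Convex ℝ Z) (hp : 2 ≤ p)
    (hF : ContDiffOn ℝ (p - 1 : ℕ) F U) (hLp : IsHighOrderSmoothOn p F Lp Z)
    (hmono : ∀ a ∈ Z, ∀ b ∈ Z, 0 ≤ (F a - F b) (a - b))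
    (hΦ : IsMirrorMapOn Φ Z) (hlam : Lp ≤ lam) {a b z : V} (ha : a ∈ Z) (hb : b ∈ Z) (hz : z ∈ Z) :
    0 ≤ (regTaylor p F Φ lam a z - regTaylor p F Φ lam b z) (a - b) := by
  have hsegZ : segment ℝ b a ⊆ Z := hZ.segment_subset hb ha
  have hcont : ContinuousOn (fun w => bregman Φ w z) (segment ℝ b a) := fun w hw =>
    (hΦ.hasFDerivAt_bregman z (hsegZ hw)).continuousAt.continuousWithinAt
  have hcomp : IsCompact (segment ℝ b a) := by
    rw [segment_eq_image_lineMap]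
    exact isCompact_Icc.image AffineMap.lineMap_continuous
  obtain ⟨c, hc, hmin⟩ := hcomp.exists_isMinOn ⟨b, left_mem_segment ℝ b a⟩ hcont
  have hcon := convex_segment (𝕜 := ℝ) b a
  have h1 := regTaylor_monotone_of_isMinOn hU hZU hZ hp hF hLp hmono hΦ hlam ha (hsegZ hc) hz
    (hmin.on_subset (hcon.segment_subset hc (right_mem_segment ℝ b a)))
  have h2 := regTaylor_monotone_of_isMinOn hU hZU hZ hp hF hLp hmono hΦ hlam hb (hsegZ hc) hz
    (hmin.on_subset (hcon.segment_subset hc (left_mem_segment ℝ b a)))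
  set T := fun w => regTaylor p F Φ lam w z with hT
  change 0 ≤ (T a - T c) (a - c) at h1
  change 0 ≤ (T b - T c) (b - c) at h2
  change 0 ≤ (T a - T b) (a - b)
  obtain ⟨s, t, hs, ht, hst, rfl⟩ := hc
  set c := s • b + t • a with hcdef
  have hac : a - c = s • (a - b) := by
    have : a = (s + t) • a := by rw [hst, one_smul]
    rw [hcdef]
    nth_rewrite 1 [this]
    module
  have hbc : b - c = -(t • (a - b)) := by
    have : b = (s + t) • b := by rw [hst, one_smul]
    rw [hcdef]
    nth_rewrite 1 [this]
    module
  have hts : t = 1 - s := by linarith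
  rw [hac, map_smul, smul_eq_mul] at h1
  rw [hbc, map_neg, map_smul, smul_eq_mul] at h2
  have e1 : (T a - T b) (a - b) = (T a - T c) (a - b) - (T b - T c) (a - b) := by
    simp only [sub_apply]; ring
  rw [e1]
  rcases hs.eq_or_lt with rfl | hs'
  · have hca : c = a := by rw [hcdef, hts]; simp
    have ht1 : t = 1 := by linarith
    rw [hca, sub_self, zero_apply]
    rw [hca, ht1] at h2
    linarith
  · rcases ht.eq_or_lt with rfl | ht'
    · have hs1 : s = 1 := by linarith
      have hcb : c = b := by rw [hcdef, hs1]; simp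
      rw [hcb, sub_self (T b), zero_apply]
      rw [hcb, hs1] at h1
      linarith
    · have h1' := nonneg_of_mul_nonneg_right h1 hs'
      have h2' : (T b - T c) (a - b) ≤ 0 := by
        by_contra hcon
        have := mul_pos ht' (not_le.1 hcon)
        linarith
      linarith

/-- The regularized Taylor expansion approximates `F` up to order `p`, with constant
`L_p(Φ, λ) / p!`. -/
theorem norm_sub_regTaylor_le (hU : IsOpen U) (hZU : Z ⊆ U) (hZ : Convex ℝ Z) (hp : 1 ≤ p)
    (hF : ContDiffOn ℝ (p - 1 : ℕ) F U) (hLp : IsHighOrderSmoothOn p F Lp Z)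
    (hΦ : IsMirrorMapOn Φ Z) (hLΦ : IsGradLipschitzOn Φ LΦ Z) (hlam : 0 ≤ lam)
    {w z : V} (hw : w ∈ Z) (hz : z ∈ Z) :
    ‖F w - regTaylor p F Φ lam w z‖ ≤ LpReg p Lp LΦ lam / (p ! : ℝ) * ‖w - z‖ ^ p := by
  obtain ⟨q, rfl⟩ : ∃ q, p = q + 1 := ⟨p - 1, by omega⟩
  have hexp : (0 : ℝ) ≤ (((q + 1 : ℕ) : ℝ) - 1) / 2 := by
    have : (0 : ℝ) ≤ q := Nat.cast_nonneg q
    push_cast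
    linarith
  have hLΦ0 := hLΦ.1
  have hD := hΦ.bregman_nonneg hw hz
  set e := (((q + 1 : ℕ) : ℝ) - 1) / 2 with he
  have hT := norm_sub_taylorPoly_le hU hZU hZ q hF hLp.2 hz hw
  have hpow : (2 * bregman Φ w z) ^ e ≤ LΦ ^ e * ‖w - z‖ ^ q := by
    have h := Real.rpow_le_rpow (by positivity)
      (bregman_le_of_isGradLipschitzOn hΦ hLΦ hZ hw hz) hexp
    rwa [Real.mul_rpow hLΦ0 (by positivity), sq_rpow_half_sub_one (by omega) (norm_nonneg _)] at h
  have hreg : F w - regTaylor (q + 1) F Φ lam w z = (F w - taylorPoly q F w z) -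
      (lam / (q ! : ℝ) * (2 * bregman Φ w z) ^ e) • (fderiv ℝ Φ w - fderiv ℝ Φ z) :=
    (sub_sub _ _ _).symm
  have hΦpow : LΦ ^ ((((q + 1 : ℕ) : ℝ) + 1) / 2) = LΦ ^ e * LΦ := by
    have : (((q + 1 : ℕ) : ℝ) + 1) / 2 = e + 1 := by rw [he]; ring
    rw [this, Real.rpow_add_one' hLΦ0 (by positivity)]
  have hfac : (((q + 1)! : ℕ) : ℝ) = (q + 1) * (q ! : ℝ) := by
    rw [Nat.factorial_succ]; push_cast; ring
  rw [hreg]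
  refine (norm_sub_le _ _).trans ?_
  rw [norm_smul, Real.norm_of_nonneg (by positivity)]
  calc _ ≤ Lp / ((q + 1)! : ℝ) * ‖w - z‖ ^ (q + 1) +
        lam / (q ! : ℝ) * (LΦ ^ e * ‖w - z‖ ^ q) * (LΦ * ‖w - z‖) := by
        gcongr
        exact hLΦ.2 w hw z hz
    _ = _ := by
        rw [LpReg, hΦpow, hfac]
        have : ((q ! : ℕ) : ℝ) ≠ 0 := by positivity
        push_cast
        field_simp
        ring

end RegTaylor

/-! ### The subproblem and the line search -/

section Search

variable {V : Type*} [NormedAddCommGroup V] [NormedSpace ℝ V]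

namespace LineSearchData

/-- What the analysis of one line search uses: the solutions of the subproblem lie in `Z`, the
set-valued operator `H` and the approximation `P` are monotone on `Z`, and `Φ` is a mirror map. -/
structure IsMonotoneOn (d : LineSearchData V) (Z : Set V) : Prop where
  mem_of_mem_H : ∀ {z w}, w ∈ d.H z → z ∈ Z
  H_mono : ∀ {z z' w w'}, w ∈ d.H z → w' ∈ d.H z' → 0 ≤ (w - w') (z - z')
  P_mono : ∀ {z z'}, z ∈ Z → z' ∈ Z → 0 ≤ (d.P z - d.P z') (z - z')
  mirror : IsMirrorMapOn d.Φ Z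

variable {d : LineSearchData V} {Z : Set V}

theorem IsMonotoneOn.mem (hd : d.IsMonotoneOn Z) {η : ℝ} {z : V} (h : d.IsSolution η z) : z ∈ Z :=
  let ⟨_, hw, _⟩ := h
  hd.mem_of_mem_H hw

/-- Solutions of the subproblem for two stepsizes, compared through the monotonicity of `P + H`. -/
theorem IsMonotoneOn.sq_norm_sub_le (hd : d.IsMonotoneOn Z) {η η' : ℝ} (hη : 0 < η) (hη' : 0 < η')
    {z z' : V} (h : d.IsSolution η z) (h' : d.IsSolution η' z') :
    ‖z' - z‖ ^ 2 ≤ (η' / η - 1) * (d.v + (fderiv ℝ d.Φ z - fderiv ℝ d.Φ d.zm)) (z' - z) := by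
  have hz := hd.mem h
  have hz' := hd.mem h'
  obtain ⟨w, hw, e⟩ := h
  obtain ⟨w', hw', e'⟩ := h'
  have h1 := hd.H_mono hw' hw
  have h2 := hd.P_mono hz' hz
  have h3 := hd.mirror.sq_norm_le hz' hz
  have k := congrArg (fun g : StrongDual ℝ V => g (z' - z)) e
  have k' := congrArg (fun g : StrongDual ℝ V => g (z' - z)) e'
  simp only [sub_apply, add_apply, smul_apply, smul_eq_mul, zero_apply] at h1 h2 h3 k k' ⊢
  generalize d.P z (z' - z) = a at *
  generalize d.P z' (z' - z) = a' at *
  generalize w (z' - z) = b at *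
  generalize w' (z' - z) = b' at *
  generalize d.v (z' - z) = c at *
  generalize fderiv ℝ d.Φ z (z' - z) = g at *
  generalize fderiv ℝ d.Φ z' (z' - z) = g' at *
  generalize fderiv ℝ d.Φ d.zm (z' - z) = g₀ at *
  have hc : c + (g - g₀) = -(η * (a + b)) := by linarith
  have hprod : η' * (a + b) ≤ η' * (a' + b') := mul_le_mul_of_nonneg_left (by linarith) hη'.le
  have hratio : (η' / η - 1) * (c + (g - g₀)) = -(η' * (a + b)) - (c + (g - g₀)) := by
    rw [hc]; field_simp; ring
  rw [hratio]
  linarith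

theorem IsMonotoneOn.solution_unique (hd : d.IsMonotoneOn Z) {η : ℝ} (hη : 0 < η) {z z' : V}
    (h : d.IsSolution η z) (h' : d.IsSolution η z') : z = z' := by
  have := hd.sq_norm_sub_le hη hη h h'
  rw [div_self hη.ne', sub_self, zero_mul] at this
  have h0 : ‖z' - z‖ = 0 := by nlinarith [norm_nonneg (z' - z)]
  exact (sub_eq_zero.1 (norm_eq_zero.1 h0)).symm

/-- Raising the stepsize by a factor moves the solution away from `zm` at most by about the same
factor. -/
theorem IsMonotoneOn.norm_sub_le (hd : d.IsMonotoneOn Z) {L : ℝ} (hL : IsGradLipschitzOn d.Φ L Z)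
    (hL1 : 1 ≤ L) (hzm : d.zm ∈ Z) {η η' : ℝ} (hη : 0 < η) (hηη' : η ≤ η') {z z' : V}
    (h : d.IsSolution η z) (h' : d.IsSolution η' z') :
    ‖z' - d.zm‖ ≤ η' / η * (L * ‖z - d.zm‖ + ‖d.v‖) := by
  have hr : 1 ≤ η' / η := (one_le_div hη).2 hηη'
  have key := hd.sq_norm_sub_le hη (hη.trans_le hηη') h h'
  have hbound : (d.v + (fderiv ℝ d.Φ z - fderiv ℝ d.Φ d.zm)) (z' - z) ≤
      (‖d.v‖ + L * ‖z - d.zm‖) * ‖z' - z‖ := by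
    have hop : ‖d.v + (fderiv ℝ d.Φ z - fderiv ℝ d.Φ d.zm)‖ ≤ ‖d.v‖ + L * ‖z - d.zm‖ :=
      (norm_add_le _ _).trans (add_le_add le_rfl (hL.2 _ (hd.mem h) _ hzm))
    exact (le_abs_self _).trans (ContinuousLinearMap.le_of_opNorm_le _ hop _)
  have h1 := key.trans (mul_le_mul_of_nonneg_left hbound (sub_nonneg.2 hr))
  have h2 : ‖z' - z‖ ≤ (η' / η - 1) * (‖d.v‖ + L * ‖z - d.zm‖) := by
    rcases (norm_nonneg (z' - z)).eq_or_lt with h0 | h0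
    · rw [← h0]
      exact mul_nonneg (sub_nonneg.2 hr) (by positivity)
    · refine le_of_mul_le_mul_right ?_ h0
      linarith
  have h3 : ‖z' - d.zm‖ ≤ ‖z' - z‖ + ‖z - d.zm‖ := norm_sub_le_norm_sub_add_norm_sub _ _ _
  have h4 : ‖z - d.zm‖ ≤ L * ‖z - d.zm‖ := le_mul_of_one_le_left (norm_nonneg _) hL1
  have h5 := norm_nonneg d.v
  linarith

/-- The outcome of a line search that does not stop the method: an admissible stepsize together with
an inadmissible one that is larger at most by the factor `1 / β`. -/
def Sandwiched (d : LineSearchData V) (η : ℝ) : Prop :=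
  ∃ up, η ≤ up ∧ up ≤ η / d.β ∧ d.Inadmissible up

theorem Bisection.sandwiched {lo up η : ℝ} (h : d.Bisection lo up η) (hlo : 0 < lo)
    (hle : lo ≤ up) (hA : d.Admissible lo) (hI : d.Inadmissible up) :
    0 < η ∧ d.Admissible η ∧ d.Sandwiched η := by
  induction h with
  | @exit lo up hr =>
    refine ⟨hlo, hA, up, hle, ?_, hI⟩
    rw [div_le_iff₀ hlo] at hr
    rwa [div_mul_eq_mul_div, one_mul] at hr
  | @raise lo up η _ hA' _ ih =>
    exact ih (Real.sqrt_pos.2 (mul_pos hlo (hlo.trans_le hle)))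
      ((Real.sqrt_le_left (hlo.le.trans hle)).2 (by nlinarith)) hA' hI
  | @lower lo up η _ hI' _ ih =>
    exact ih hlo (Real.le_sqrt_of_sq_le (by nlinarith)) hA hI'

theorem BacktrackLoop.spec {σ η ηup lo up : ℝ} (h : d.BacktrackLoop σ η ηup lo up)
    (hβ₀ : 0 < d.β) (hβ₁ : d.β < 1) (hη : 0 < η) (hησ : η ≤ σ) (hle : η ≤ ηup)
    (hI : d.Inadmissible ηup) :
    0 < lo ∧ lo ≤ up ∧ d.Admissible lo ∧ d.Inadmissible up := by
  induction h with
  | exit hA => exact ⟨hη, hle, hA, hI⟩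
  | @next η ηup lo up hI' _ ih =>
    have hσ : 0 < σ := hη.trans_le hησ
    have hdec : d.β * η ^ 2 / σ ≤ η := by
      rw [div_le_iff₀ hσ]
      have h1 : d.β * η ^ 2 ≤ 1 * η ^ 2 := by gcongr
      nlinarith
    exact ih (by positivity) (hdec.trans hησ) hdec hI'

theorem AdvanceLoop.spec {σ ηlo η lo up : ℝ} (h : d.AdvanceLoop σ ηlo η lo up)
    (hβ₀ : 0 < d.β) (hβ₁ : d.β < 1) (hσ : 0 < σ) (hlo : 0 < ηlo) (hση : σ ≤ η) (hle : ηlo ≤ η)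
    (hA : d.Admissible ηlo) :
    0 < lo ∧ d.Admissible lo ∧ (d.Accurate lo ∨ lo ≤ up ∧ d.Inadmissible up) := by
  induction h with
  | exit_accurate h => exact ⟨hlo, hA, Or.inl h⟩
  | exit_inadmissible hI => exact ⟨hlo, hA, Or.inr ⟨hle, hI⟩⟩
  | @next ηlo η lo up _ hA' _ ih =>
    have hη : 0 < η := hlo.trans_le hle
    have hinc : η ≤ η ^ 2 / (d.β * σ) := by
      rw [le_div_iff₀ (mul_pos hβ₀ hσ)]
      have h1 : d.β * σ ≤ 1 * σ := by gcongr
      nlinarith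
    exact ih hη (hση.trans hinc) hinc hA'

theorem LineSearch.spec (hd : d.IsMonotoneOn Z) {σ η : ℝ} (h : d.LineSearch σ η)
    (hβ₀ : 0 < d.β) (hβ₁ : d.β < 1) (hσ : 0 < σ) :
    0 < η ∧ d.Admissible η ∧ (d.Accurate η ∨ d.Sandwiched η) := by
  have hinit : σ ≤ σ / d.β := by
    rw [le_div_iff₀ hβ₀]
    nlinarith
  cases h with
  | @backtrack lo up _ hI hB hbis =>
    have hβσ : d.β * σ ≤ σ := by nlinarith
    obtain ⟨h1, h2, h3, h4⟩ := hB.spec hβ₀ hβ₁ (mul_pos hβ₀ hσ) hβσ hβσ hI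
    obtain ⟨k1, k2, k3⟩ := hbis.sandwiched h1 h2 h3 h4
    exact ⟨k1, k2, Or.inr k3⟩
  | advance_accurate hA hadv hacc =>
    obtain ⟨h1, h2, _⟩ := hadv.spec hβ₀ hβ₁ hσ hσ hinit hinit hA
    exact ⟨h1, h2, Or.inl hacc⟩
  | @advance_bisect lo up _ hA hadv hinacc hbis =>
    obtain ⟨h1, h2, h3⟩ := hadv.spec hβ₀ hβ₁ hσ hσ hinit hinit hA
    rcases h3 with ⟨z, hz, hacc⟩ | ⟨hle, hI⟩
    · -- `lo` cannot be both accurate and inaccurate, as the subproblem has one solution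
      obtain ⟨z', hz', hinacc⟩ := hinacc
      rw [hd.solution_unique h1 hz hz'] at hacc
      exact absurd hacc (not_le.2 hinacc)
    · obtain ⟨k1, k2, k3⟩ := hbis.sandwiched h1 hle h2 hI
      exact ⟨k1, k2, Or.inr k3⟩

end LineSearchData

end Search

/-! ### The sum of the stepsizes -/

/-- A lower bound for the sum of the stepsizes: if `η_k ≥ 1 / (C s_k^m)`, then Hölder's inequality
with exponents `(m + 2) / 2` and `(m + 2) / m` bounds the sum of the `η_k` in terms of the sum of
the `s_k²`. -/
theorem inv_sum_le_of_one_le_mul_pow {N m : ℕ} (hN : 1 ≤ N) (hm : 1 ≤ m) {η s : ℕ → ℝ} {C Q : ℝ}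
    (hC : 0 ≤ C) (hη : ∀ k < N, 0 < η k) (hs : ∀ k < N, 0 ≤ s k)
    (h : ∀ k < N, 1 ≤ C * η k * s k ^ m) (hQ : ∑ k ∈ Finset.range N, s k ^ 2 ≤ Q) :
    (∑ k ∈ Finset.range N, η k)⁻¹ ≤ C * Q ^ ((m : ℝ) / 2) * (N : ℝ) ^ (-(((m : ℝ) + 2) / 2)) := by
  have hm0 : (0 : ℝ) < m := by exact_mod_cast hm
  have hN0 : (0 : ℝ) < N := by exact_mod_cast hN
  have hsum : 0 < ∑ k ∈ Finset.range N, η k :=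
    Finset.sum_pos (fun k hk => hη k (Finset.mem_range.1 hk)) ⟨0, Finset.mem_range.2 hN⟩
  have hsq : 0 ≤ ∑ k ∈ Finset.range N, s k ^ 2 := Finset.sum_nonneg fun k _ => sq_nonneg _
  have hconj : (((m : ℝ) + 2) / 2).HolderConjugate (((m : ℝ) + 2) / m) := by
    rw [Real.holderConjugate_iff]
    constructor
    · linarith
    · field_simp
      ring
  set a : ℝ := 2 / (m + 2) with ha
  set b : ℝ := m / (m + 2) with hb
  have hholder := Real.inner_le_Lp_mul_Lq_of_nonneg (Finset.range N) hconj
    (f := fun k => (C * η k) ^ a) (g := fun k => (s k ^ 2) ^ b)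
    (fun k hk => Real.rpow_nonneg (mul_nonneg hC (hη k (Finset.mem_range.1 hk)).le) _)
    (fun k hk => by positivity)
  have hf : ∀ k ∈ Finset.range N, ((C * η k) ^ a) ^ (((m : ℝ) + 2) / 2) = C * η k := fun k hk => by
    rw [← Real.rpow_mul (mul_nonneg hC (hη k (Finset.mem_range.1 hk)).le)]
    rw [show a * (((m : ℝ) + 2) / 2) = 1 by rw [ha]; field_simp, Real.rpow_one]
  have hg : ∀ k ∈ Finset.range N, ((s k ^ 2) ^ b) ^ (((m : ℝ) + 2) / m) = s k ^ 2 := fun k _ => by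
    rw [← Real.rpow_mul (sq_nonneg _)]
    rw [show b * (((m : ℝ) + 2) / m) = 1 by rw [hb]; field_simp, Real.rpow_one]
  rw [Finset.sum_congr rfl hf, Finset.sum_congr rfl hg, ← Finset.mul_sum] at hholder
  have hone : ∀ k ∈ Finset.range N, 1 ≤ (C * η k) ^ a * (s k ^ 2) ^ b := fun k hk => by
    have hk := Finset.mem_range.1 hk
    have e : (s k ^ 2) ^ b = (s k ^ m) ^ a := by
      rw [← Real.rpow_natCast_mul (hs k hk), ← Real.rpow_natCast_mul (hs k hk)]
      congr 1
      rw [ha, hb]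
      push_cast
      ring
    rw [e, ← Real.mul_rpow (mul_nonneg hC (hη k hk).le) (pow_nonneg (hs k hk) _)]
    exact Real.one_le_rpow (h k hk) (by positivity)
  have hcount : (N : ℝ) ≤ ∑ k ∈ Finset.range N, (C * η k) ^ a * (s k ^ 2) ^ b := by
    simpa using Finset.card_nsmul_le_sum (Finset.range N) _ 1 hone
  have hraise := Real.rpow_le_rpow hN0.le (hcount.trans hholder)
    (by positivity : 0 ≤ ((m : ℝ) + 2) / 2)
  have hCη : 0 ≤ C * ∑ k ∈ Finset.range N, η k := mul_nonneg hC hsum.le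
  rw [Real.mul_rpow (by positivity) (by positivity), ← Real.rpow_mul hCη, ← Real.rpow_mul hsq,
    show 1 / (((m : ℝ) + 2) / 2) * (((m : ℝ) + 2) / 2) = 1 by field_simp, Real.rpow_one,
    show 1 / (((m : ℝ) + 2) / m) * (((m : ℝ) + 2) / 2) = m / 2 by field_simp] at hraise
  have hQ' : (∑ k ∈ Finset.range N, s k ^ 2) ^ ((m : ℝ) / 2) ≤ Q ^ ((m : ℝ) / 2) :=
    Real.rpow_le_rpow hsq hQ (by positivity)
  have hfinal := hraise.trans (mul_le_mul_of_nonneg_left hQ' hCη)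
  rw [Real.rpow_neg hN0.le, ← div_eq_mul_inv, le_div_iff₀ (by positivity),
    inv_mul_le_iff₀ hsum]
  linarith

theorem sum_sq_add_shift_le {V : Type*} [SeminormedAddCommGroup V] {a b : ℝ}
    (ha : 0 ≤ a) (hb : 0 ≤ b) (z : ℕ → V) (N : ℕ) :
    ∑ k ∈ Finset.range N, (a * ‖z (k + 1) - z k‖ + b * ‖z k - z (k - 1)‖) ^ 2 ≤
      (a + b) ^ 2 * ∑ k ∈ Finset.range N, ‖z (k + 1) - z k‖ ^ 2 := by
  have hshift : ∑ k ∈ Finset.range N, ‖z k - z (k - 1)‖ ^ 2 ≤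
      ∑ k ∈ Finset.range N, ‖z (k + 1) - z k‖ ^ 2 := by
    cases N with
    | zero => simp
    | succ N =>
      rw [Finset.sum_range_succ', Finset.sum_range_succ]
      simp
  have hterm : ∀ k ∈ Finset.range N, (a * ‖z (k + 1) - z k‖ + b * ‖z k - z (k - 1)‖) ^ 2 ≤
      (a + b) * (a * ‖z (k + 1) - z k‖ ^ 2 + b * ‖z k - z (k - 1)‖ ^ 2) := fun k _ => by
    have := mul_nonneg (mul_nonneg ha hb) (sq_nonneg (‖z (k + 1) - z k‖ - ‖z k - z (k - 1)‖))
    linarith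
  refine (Finset.sum_le_sum hterm).trans ?_
  rw [← Finset.mul_sum, Finset.sum_add_distrib, ← Finset.mul_sum, ← Finset.mul_sum]
  have h := mul_le_mul_of_nonneg_left hshift (mul_nonneg (add_nonneg ha hb) hb)
  linarith

theorem gammaP_pow {p : ℕ} (hp : 2 ≤ p) {LΦ α β : ℝ} (hα₀ : 0 < α) (hα₁ : α < 1)
    (hβ : 0 < β) :
    gammaP p LΦ α β ^ (p - 1) = 2 / ((p ! : ℝ) * α * β ^ p) *
      (√(2 / (1 - α)) *
        (LΦ ^ ((3 : ℝ) / 2) + (β + LΦ ^ ((1 : ℝ) / 2)) * (α / 2))) ^ (p - 1) := by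
  have h1α : 0 < 1 - α := by linarith
  have hroot : 1 / √(2 * (1 - α)) = √(2 / (1 - α)) / 2 := by
    have e : 2 / (1 - α) = (2 / √(2 * (1 - α))) ^ 2 := by
      rw [div_pow, Real.sq_sqrt (by positivity)]
      field_simp
    rw [e, Real.sqrt_sq (by positivity)]
    ring
  have hκ : ((2 / ((p ! : ℝ) * α * β ^ p)) ^ (1 / ((p : ℝ) - 1))) ^ (p - 1) =
      2 / ((p ! : ℝ) * α * β ^ p) := by
    have hp1 : ((p - 1 : ℕ) : ℝ) = p - 1 := by push_cast [Nat.cast_sub (by omega : 1 ≤ p)]; rfl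
    have hp2 : (p : ℝ) - 1 ≠ 0 := by
      have : (2 : ℝ) ≤ p := by exact_mod_cast hp
      linarith
    rw [← Real.rpow_mul_natCast (by positivity), hp1, one_div_mul_cancel hp2, Real.rpow_one]
  rw [gammaP, hroot, ← hκ, ← mul_pow]
  congr 1
  rw [hκ]
  ring

/-! ### The optimistic method -/

section Run

variable {V : Type*} [NormedAddCommGroup V] [NormedSpace ℝ V]

/-- What the analysis of the method uses of the problem: `H` is monotone with domain in `Z`, `Φ`
is a smooth mirror map, and the regularized Taylor expansion is monotone and approximates `F` to
order `p` with constant `M / p!`. -/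
structure IsRegularProblem (p : ℕ) (F : V → StrongDual ℝ V) (H : V → Set (StrongDual ℝ V))
    (Φ : V → ℝ) (lam LΦ M : ℝ) (Z : Set V) : Prop where
  mem_of_mem_H : ∀ {z w}, w ∈ H z → z ∈ Z
  H_mono : ∀ {z z' w w'}, w ∈ H z → w' ∈ H z' → 0 ≤ (w - w') (z - z')
  mirror : IsMirrorMapOn Φ Z
  smooth : IsGradLipschitzOn Φ LΦ Z
  regTaylor_mono : ∀ {a b z}, a ∈ Z → b ∈ Z → z ∈ Z →
    0 ≤ (regTaylor p F Φ lam a z - regTaylor p F Φ lam b z) (a - b)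
  M_nonneg : 0 ≤ M
  regTaylor_error : ∀ {w z}, w ∈ Z → z ∈ Z →
    ‖F w - regTaylor p F Φ lam w z‖ ≤ M / (p ! : ℝ) * ‖w - z‖ ^ p

variable {p : ℕ} {F : V → StrongDual ℝ V} {H : V → Set (StrongDual ℝ V)} {Φ : V → ℝ}
  {lam LΦ M σ₀ α β ε : ℝ} {Z : Set V} {N : ℕ} {z : ℕ → V} {η : ℕ → ℝ}

theorem IsRegularProblem.isMonotoneOn (hP : IsRegularProblem p F H Φ lam LΦ M Z) {k : ℕ}
    (hk : z k ∈ Z) : (iterData p F H Φ lam α β ε z η k).IsMonotoneOn Z where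
  mem_of_mem_H := hP.mem_of_mem_H
  H_mono := hP.H_mono
  P_mono := fun ha hb => hP.regTaylor_mono ha hb hk
  mirror := hP.mirror

namespace IsMethodRun

theorem mem (hrun : IsMethodRun p F H Φ lam σ₀ α β ε N z η)
    (hP : IsRegularProblem p F H Φ lam LΦ M Z) (hz₀ : z 0 ∈ Z) {k : ℕ} (hk : k ≤ N) : z k ∈ Z := by
  cases k with
  | zero => exact hz₀
  | succ k =>
    obtain ⟨w, hw, _⟩ := hrun.update k hk
    exact hP.mem_of_mem_H hw

theorem lineSearch_spec (hrun : IsMethodRun p F H Φ lam σ₀ α β ε N z η)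
    (hP : IsRegularProblem p F H Φ lam LΦ M Z) (hz₀ : z 0 ∈ Z) (hσ₀ : 0 < σ₀) (hβ₀ : 0 < β)
    (hβ₁ : β < 1) {k : ℕ} (hk : k < N) :
    0 < η k ∧ (iterData p F H Φ lam α β ε z η k).Admissible (η k) ∧
      ((iterData p F H Φ lam α β ε z η k).Accurate (η k) ∨
        (iterData p F H Φ lam α β ε z η k).Sandwiched (η k)) := by
  have hstep : 0 < trialStep σ₀ β η k := by
    induction k with
    | zero => exact hσ₀
    | succ k ih =>
      have hk' : k < N := by omega
      exact div_pos ((hrun.lineSearch k hk').spec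
        (hP.isMonotoneOn (hrun.mem hP hz₀ hk'.le)) hβ₀ hβ₁ (ih hk')).1 hβ₀
  exact (hrun.lineSearch k hk).spec (hP.isMonotoneOn (hrun.mem hP hz₀ hk.le)) hβ₀ hβ₁ hstep

/-- The correction is controlled by the last step.  For `k = 0` both sides vanish, since `0 - 1 = 0`
in the natural numbers. -/
theorem norm_correction_le (hrun : IsMethodRun p F H Φ lam σ₀ α β ε N z η)
    (hP : IsRegularProblem p F H Φ lam LΦ M Z) (hz₀ : z 0 ∈ Z) (hσ₀ : 0 < σ₀) (hβ₀ : 0 < β)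
    (hβ₁ : β < 1) {k : ℕ} (hk : k ≤ N) :
    ‖correction p F Φ lam z η k‖ ≤ α / 2 * ‖z k - z (k - 1)‖ := by
  cases k with
  | zero => simp [correction]
  | succ k =>
    obtain ⟨hη, ⟨z', hz', hstep⟩, _⟩ := hrun.lineSearch_spec hP hz₀ hσ₀ hβ₀ hβ₁ hk
    rw [(hP.isMonotoneOn (hrun.mem hP hz₀ (Nat.le_of_succ_le hk))).solution_unique hη hz'
      (hrun.update k hk)] at hstep
    rw [correction, norm_smul, Real.norm_of_nonneg hη.le, Nat.add_sub_cancel]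
    exact hstep

/-- The energy inequality of the method.  The corrections telescope, and the error that each of them
leaves is absorbed by the Bregman distances of two consecutive steps. -/
theorem energy_inequality (hrun : IsMethodRun p F H Φ lam σ₀ α β ε N z η)
    (hP : IsRegularProblem p F H Φ lam LΦ M Z) (hz₀ : z 0 ∈ Z) (hσ₀ : 0 < σ₀) (hα : 0 < α)
    (hβ₀ : 0 < β) (hβ₁ : β < 1) :
    ∃ w : ℕ → StrongDual ℝ V, (∀ k < N, w k ∈ H (z (k + 1))) ∧ ∀ u ∈ Z, ∀ n ≤ N,
      ∑ k ∈ Finset.range n, η k * (F (z (k + 1)) + w k) (z (k + 1) - u) +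
        (1 - α / 2) * bregman Φ u (z n) +
        (1 - α) / 2 * ∑ k ∈ Finset.range n, ‖z (k + 1) - z k‖ ^ 2 ≤ bregman Φ u (z 0) := by
  have hsol : ∀ k, ∃ w : StrongDual ℝ V, k < N → w ∈ H (z (k + 1)) ∧
      η k • regTaylor p F Φ lam (z (k + 1)) (z k) + correction p F Φ lam z η k + η k • w +
        fderiv ℝ Φ (z (k + 1)) - fderiv ℝ Φ (z k) = 0 := by
    intro k
    by_cases hk : k < N
    · obtain ⟨w, hw⟩ := hrun.update k hk
      exact ⟨w, fun _ => hw⟩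
    · exact ⟨0, fun h => absurd h hk⟩
  choose w hw using hsol
  refine ⟨w, fun k hk => (hw k hk).1, fun u hu n hn => ?_⟩
  have hcorr := fun {k : ℕ} (hk : k ≤ N) => hrun.norm_correction_le hP hz₀ hσ₀ hβ₀ hβ₁ hk
  have key : ∀ n ≤ N, ∑ k ∈ Finset.range n, η k * (F (z (k + 1)) + w k) (z (k + 1) - u) -
      correction p F Φ lam z η n (z n - u) + bregman Φ u (z n) +
      (1 - α) / 2 * ∑ k ∈ Finset.range n, ‖z (k + 1) - z k‖ ^ 2 +
      α / 4 * ‖z n - z (n - 1)‖ ^ 2 ≤ bregman Φ u (z 0) := by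
    intro n
    induction n with
    | zero => simp [correction]
    | succ n ih =>
      intro hn
      have hn' : n < N := hn
      have ih := ih hn'.le
      rw [Finset.sum_range_succ, Finset.sum_range_succ, Nat.add_sub_cancel]
      have hD := hP.mirror.half_sq_le_bregman (hrun.mem hP hz₀ hn) (hrun.mem hP hz₀ hn'.le)
      have hv : -(correction p F Φ lam z η n (z (n + 1) - z n)) ≤
          α / 2 * ‖z n - z (n - 1)‖ * ‖z (n + 1) - z n‖ :=
        (neg_le_abs _).trans (ContinuousLinearMap.le_of_opNorm_le _ (hcorr hn'.le) _)
      have hyoung := mul_nonneg hα.le (sq_nonneg (‖z n - z (n - 1)‖ - ‖z (n + 1) - z n‖))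
      have e1 := congrArg (fun g : StrongDual ℝ V => g (z (n + 1) - u)) (hw n hn').2
      have e2 := fderiv_sub_fderiv_apply_sub Φ (z (n + 1)) (z n) u
      have e3 : correction p F Φ lam z η n (z (n + 1) - u) =
          correction p F Φ lam z η n (z n - u) + correction p F Φ lam z η n (z (n + 1) - z n) := by
        rw [← map_add]
        congr 1
        abel
      have e4 : correction p F Φ lam z η (n + 1) (z (n + 1) - u) =
          η n * (F (z (n + 1)) (z (n + 1) - u) -
            regTaylor p F Φ lam (z (n + 1)) (z n) (z (n + 1) - u)) := rfl
      rw [e4]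
      simp only [sub_apply, add_apply, smul_apply, smul_eq_mul, zero_apply] at e1 e2 ⊢
      rw [e3] at e1
      generalize ‖z n - z (n - 1)‖ = s at *
      generalize ‖z (n + 1) - z n‖ = t at *
      linear_combination ih + e1 - e2 + hv + hD + hyoung / 4
  have h1 := key n hn
  have h2 : correction p F Φ lam z η n (z n - u) ≤
      α / 2 * ‖z n - z (n - 1)‖ * ‖z n - u‖ :=
    (le_abs_self _).trans (ContinuousLinearMap.le_of_opNorm_le _ (hcorr hn) _)
  have h3 := mul_le_mul_of_nonneg_left
    (hP.mirror.half_sq_le_bregman hu (hrun.mem hP hz₀ hn)) hα.le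
  rw [norm_sub_rev] at h3
  have hyoung := mul_nonneg hα.le (sq_nonneg (‖z n - z (n - 1)‖ - ‖z n - u‖))
  generalize ‖z n - z (n - 1)‖ = s at *
  generalize ‖z n - u‖ = t at *
  linear_combination h1 + h2 + hyoung / 4 + h3 / 2

/-- The stepsize is bounded below in terms of the last two steps, because a stepsize larger by at
most the factor `1 / β` was inadmissible. -/
theorem one_le_stepsize (hrun : IsMethodRun p F H Φ lam σ₀ α β ε N z η)
    (hP : IsRegularProblem p F H Φ lam LΦ M Z) (hp : 1 ≤ p) (hz₀ : z 0 ∈ Z) (hσ₀ : 0 < σ₀)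
    (hα : 0 < α) (hβ₀ : 0 < β) (hβ₁ : β < 1) {k : ℕ} (hk : k < N)
    (hsand : (iterData p F H Φ lam α β ε z η k).Sandwiched (η k)) :
    1 ≤ M * (2 / ((p ! : ℝ) * α * β ^ p)) * η k *
      (LΦ ^ ((3 : ℝ) / 2) * ‖z (k + 1) - z k‖ +
        (β + LΦ ^ ((1 : ℝ) / 2)) * (α / 2 * ‖z k - z (k - 1)‖)) ^ (p - 1) := by
  have hzk := hrun.mem hP hz₀ hk.le
  have hmon := hP.isMonotoneOn (α := α) (β := β) (ε := ε) (η := η) hzk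
  have hη := (hrun.lineSearch_spec hP hz₀ hσ₀ hβ₀ hβ₁ hk).1
  have hcorr := hrun.norm_correction_le hP hz₀ hσ₀ hβ₀ hβ₁ hk.le
  obtain ⟨up, hle, hup, z', hz', hfail⟩ := hsand
  have hup' : up ≤ η k / β := hup
  have hup0 : 0 < up := hη.trans_le hle
  have hz'Z : z' ∈ Z := hmon.mem hz'
  have hM := hP.M_nonneg
  have herr := mul_le_mul_of_nonneg_left (hP.regTaylor_error hz'Z hzk) hup0.le
  have hfail' : α / 2 * ‖z' - z k‖ < up * (M / (p ! : ℝ) * ‖z' - z k‖ ^ p) :=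
    (not_le.1 hfail).trans_le herr
  have hd : 0 < ‖z' - z k‖ := by
    refine (norm_nonneg _).lt_of_ne fun h0 => ?_
    rw [← h0, zero_pow (by omega)] at hfail'
    simp at hfail'
  have hL1 : 1 ≤ LΦ := one_le_of_isGradLipschitzOn hP.mirror hP.smooth hz'Z hzk
    (sub_ne_zero.1 (norm_pos_iff.1 hd))
  have hdist : ‖z' - z k‖ ≤
      up / η k * (LΦ * ‖z (k + 1) - z k‖ + ‖correction p F Φ lam z η k‖) :=
    hmon.norm_sub_le hP.smooth hL1 hzk hη hle (hrun.update k hk) hz'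
  have hL32 : LΦ ≤ LΦ ^ ((3 : ℝ) / 2) := by
    simpa using Real.rpow_le_rpow_of_exponent_le hL1 (by norm_num : (1 : ℝ) ≤ 3 / 2)
  have hL12 : 1 ≤ β + LΦ ^ ((1 : ℝ) / 2) := by
    have := Real.one_le_rpow hL1 (by norm_num : (0 : ℝ) ≤ 1 / 2)
    linarith
  set s := LΦ ^ ((3 : ℝ) / 2) * ‖z (k + 1) - z k‖ +
    (β + LΦ ^ ((1 : ℝ) / 2)) * (α / 2 * ‖z k - z (k - 1)‖) with hs
  have hbound : LΦ * ‖z (k + 1) - z k‖ + ‖correction p F Φ lam z η k‖ ≤ s :=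
    add_le_add (mul_le_mul_of_nonneg_right hL32 (norm_nonneg _))
      (hcorr.trans (le_mul_of_one_le_left (by positivity) hL12))
  have hs0 : 0 ≤ s := by positivity
  have hratio : up / η k ≤ 1 / β := by
    rw [div_le_div_iff₀ hη hβ₀]
    rw [le_div_iff₀ hβ₀] at hup'
    linarith
  have hdist' : ‖z' - z k‖ ≤ 1 / β * s := hdist.trans (by gcongr)
  have hpow : ‖z' - z k‖ ^ p = ‖z' - z k‖ ^ (p - 1) * ‖z' - z k‖ := by
    rw [← pow_succ, Nat.sub_add_cancel hp]
  have hhalf : α / 2 ≤ η k / β * (M / (p ! : ℝ) * (1 / β * s) ^ (p - 1)) := by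
    have h1 : α / 2 < up * (M / (p ! : ℝ) * ‖z' - z k‖ ^ (p - 1)) := by
      rw [hpow] at hfail'
      refine lt_of_mul_lt_mul_right ?_ hd.le
      linarith
    refine h1.le.trans ?_
    gcongr
  have hβp : β ^ p = β ^ (p - 1) * β := by rw [← pow_succ, Nat.sub_add_cancel hp]
  have hfact : (0 : ℝ) < (p ! : ℝ) := by positivity
  calc (1 : ℝ) = 2 / α * (α / 2) := by field_simp
    _ ≤ 2 / α * (η k / β * (M / (p ! : ℝ) * (1 / β * s) ^ (p - 1))) := by gcongr
    _ = _ := by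
      rw [mul_pow, hβp, one_div, inv_pow]
      field_simp

/-- If the method has not reached the accuracy after `N` iterations, then every line search ended
with an inadmissible stepsize close to the one returned. -/
theorem sandwiched_of_lt_residual (hrun : IsMethodRun p F H Φ lam σ₀ α β ε N z η)
    (hP : IsRegularProblem p F H Φ lam LΦ M Z) (hz₀ : z 0 ∈ Z) (hσ₀ : 0 < σ₀) (hβ₀ : 0 < β)
    (hβ₁ : β < 1) (hres : ENNReal.ofReal ε < residual F H (z N)) {k : ℕ} (hk : k < N) :
    (iterData p F H Φ lam α β ε z η k).Sandwiched (η k) := by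
  obtain ⟨hη, _, ⟨z', hz', hacc⟩ | h⟩ := hrun.lineSearch_spec hP hz₀ hσ₀ hβ₀ hβ₁ hk
  · exfalso
    rw [(hP.isMonotoneOn (hrun.mem hP hz₀ hk.le)).solution_unique hη hz' (hrun.update k hk)] at hacc
    refine (not_lt.2 hacc) ?_
    rcases (Nat.succ_le_of_lt hk).eq_or_lt with h | h
    · subst h
      exact hres
    · exact hrun.not_stopped k h
  · exact h

/-- The rate of growth of the sum of the stepsizes, given the bound on the sum of the squared steps
that the energy inequality provides. -/
theorem inv_sum_stepsize_le (hrun : IsMethodRun p F H Φ lam σ₀ α β ε N z η)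
    (hP : IsRegularProblem p F H Φ lam LΦ M Z) (hp : 2 ≤ p) (hz₀ : z 0 ∈ Z) (hσ₀ : 0 < σ₀)
    (hα₀ : 0 < α) (hα₁ : α < 1) (hβ₀ : 0 < β) (hβ₁ : β < 1) (hN : 1 ≤ N)
    (hres : ENNReal.ofReal ε < residual F H (z N)) {R : ℝ} (hR : 0 ≤ R)
    (hsteps : (1 - α) / 2 * ∑ k ∈ Finset.range N, ‖z (k + 1) - z k‖ ^ 2 ≤ R) :
    (∑ k ∈ Finset.range N, η k)⁻¹ ≤ gammaP p LΦ α β ^ (p - 1) * M * R ^ (((p : ℝ) - 1) / 2) *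
      (N : ℝ) ^ (-(((p : ℝ) + 1) / 2)) := by
  have hLΦ := hP.smooth.1
  have hM := hP.M_nonneg
  have h1α : 0 < 1 - α := by linarith
  set a := LΦ ^ ((3 : ℝ) / 2) with ha
  set b := (β + LΦ ^ ((1 : ℝ) / 2)) * (α / 2) with hb
  have ha0 : 0 ≤ a := by positivity
  have hb0 : 0 ≤ b := by positivity
  set B := √(2 / (1 - α)) * (a + b) with hB
  have hB0 : 0 ≤ B := by positivity
  have hQ : ∑ k ∈ Finset.range N, (a * ‖z (k + 1) - z k‖ + b * ‖z k - z (k - 1)‖) ^ 2 ≤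
      B ^ 2 * R := by
    refine (sum_sq_add_shift_le ha0 hb0 z N).trans ?_
    rw [hB, mul_pow, Real.sq_sqrt (by positivity), mul_comm (2 / (1 - α)), mul_assoc]
    refine mul_le_mul_of_nonneg_left ?_ (sq_nonneg _)
    rw [div_mul_eq_mul_div, le_div_iff₀ h1α]
    linarith
  have hm : ((p - 1 : ℕ) : ℝ) = p - 1 := by push_cast [Nat.cast_sub (by omega : 1 ≤ p)]; rfl
  have h := inv_sum_le_of_one_le_mul_pow (m := p - 1)
    (s := fun k => a * ‖z (k + 1) - z k‖ + b * ‖z k - z (k - 1)‖)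
    (C := M * (2 / ((p ! : ℝ) * α * β ^ p))) hN (by omega) (by positivity)
    (fun k hk => (hrun.lineSearch_spec hP hz₀ hσ₀ hβ₀ hβ₁ hk).1) (fun k _ => by positivity)
    (fun k hk => by
      have := hrun.one_le_stepsize hP (by omega) hz₀ hσ₀ hα₀ hβ₀ hβ₁ hk
        (hrun.sandwiched_of_lt_residual hP hz₀ hσ₀ hβ₀ hβ₁ hres hk)
      rwa [← mul_assoc (β + LΦ ^ ((1 : ℝ) / 2))] at this) hQ
  rw [hm, Real.mul_rpow (sq_nonneg _) hR, sq_rpow_half_sub_one (by omega) hB0,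
    show (p : ℝ) - 1 + 2 = p + 1 by ring] at h
  rw [gammaP_pow hp hα₀ hα₁ hβ₀]
  exact h.trans_eq (by ring)

end IsMethodRun

end Run

/-! ### The saddle point problem -/

theorem ConvexOn.add_fderiv_le {V : Type*} [NormedAddCommGroup V] [NormedSpace ℝ V] {S : Set V}
    {g : V → ℝ} (hg : ConvexOn ℝ S g) {x x' : V} (hx : x ∈ S) (hx' : x' ∈ S)
    {g' : V →L[ℝ] ℝ} (hd : HasFDerivAt g g' x) : g x + g' (x' - x) ≤ g x' := by
  have hline : HasDerivAt (fun t : ℝ => x + t • (x' - x)) (x' - x) 0 := by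
    simpa using ((hasDerivAt_id (0 : ℝ)).smul_const (x' - x)).const_add x
  have hd' : HasFDerivAt g g' (x + (0 : ℝ) • (x' - x)) := by simpa using hd
  have hderiv : HasDerivAt (fun t : ℝ => g (x + t • (x' - x))) (g' (x' - x)) 0 :=
    HasFDerivAt.comp_hasDerivAt (0 : ℝ) hd' hline
  have hconv : ConvexOn ℝ (Icc (0 : ℝ) 1) fun t : ℝ => g (x + t • (x' - x)) := by
    have h := hg.comp_affineMap (AffineMap.lineMap x x')
    refine (h.subset (fun t ht => ?_) (convex_Icc 0 1)).congr fun t _ => ?_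
    · exact hg.1.lineMap_mem hx hx' ht
    · simp [AffineMap.lineMap_apply, add_comm]
  have h := hconv.le_slope_of_hasDerivAt (left_mem_Icc.2 zero_le_one) (right_mem_Icc.2 zero_le_one)
    zero_lt_one hderiv
  simp only [slope_def_field, one_smul, zero_smul, add_zero, add_sub_cancel, sub_zero, div_one] at h
  linarith

theorem IsProperClosedConvex.convexOn_toReal {V : Type*} [NormedAddCommGroup V] [NormedSpace ℝ V]
    {h : V → EReal} (hh : IsProperClosedConvex h) :
    ConvexOn ℝ {x | h x ≠ ⊤} fun x => (h x).toReal := by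
  have key : ∀ ⦃x⦄, h x ≠ ⊤ → ∀ ⦃y⦄, h y ≠ ⊤ → ∀ ⦃s t : ℝ⦄, 0 ≤ s → 0 ≤ t → s + t = 1 →
      h (s • x + t • y) ≤ ((s * (h x).toReal + t * (h y).toReal : ℝ) : EReal) := by
    intro x hx y hy s t hs ht hst
    have h1 : (x, (h x).toReal) ∈ {q : V × ℝ | h q.1 ≤ (q.2 : EReal)} := EReal.le_coe_toReal hx
    have h2 : (y, (h y).toReal) ∈ {q : V × ℝ | h q.1 ≤ (q.2 : EReal)} := EReal.le_coe_toReal hy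
    exact hh.convex h1 h2 hs ht hst
  refine ⟨fun x hx y hy s t hs ht hst => ?_, fun x hx y hy s t hs ht hst => ?_⟩
  · exact ne_top_of_le_ne_top (EReal.coe_ne_top _) (key hx hy hs ht hst)
  · have := EReal.toReal_le_toReal (key hx hy hs ht hst) (hh.ne_bot _) (EReal.coe_ne_top _)
    rwa [EReal.toReal_coe] at this

theorem ne_top_of_mem_subdifferential {V : Type*} [NormedAddCommGroup V] [NormedSpace ℝ V]
    {h : V → EReal} (hh : IsProperClosedConvex h) {x : V} {g : StrongDual ℝ V}
    (hg : g ∈ subdifferential h x) : h x ≠ ⊤ := by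
  intro htop
  obtain ⟨x', hx'⟩ := hh.exists_ne_top
  have := hg x'
  rw [htop, EReal.top_add_coe, top_le_iff] at this
  exact hx' this

theorem subdifferential_toReal_le {V : Type*} [NormedAddCommGroup V] [NormedSpace ℝ V]
    {h : V → EReal} (hh : IsProperClosedConvex h) {x x' : V} {g : StrongDual ℝ V}
    (hg : g ∈ subdifferential h x) (hx' : h x' ≠ ⊤) :
    (h x).toReal + g (x' - x) ≤ (h x').toReal := by
  have := hg x'
  rw [← EReal.coe_toReal (ne_top_of_mem_subdifferential hh hg) (hh.ne_bot x),
    ← EReal.coe_toReal hx' (hh.ne_bot x')] at this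
  exact_mod_cast this

section SaddlePoint

variable {E G : Type*} [NormedAddCommGroup E] [NormedSpace ℝ E]
  [NormedAddCommGroup G] [NormedSpace ℝ G] {X : Set E} {Y : Set G} {h₁ : E → EReal}
  {h₂ : G → EReal} {f : WithLp 2 (E × G) → ℝ} {ΦX : E → ℝ} {ΦY : G → ℝ}

theorem convex_feasible (hX : Convex ℝ X) (hY : Convex ℝ Y) : Convex ℝ (feasible X Y) :=
  (hX.linear_preimage (WithLp.fstL 2 ℝ E G).toLinearMap).inter
    (hY.linear_preimage (WithLp.sndL 2 ℝ E G).toLinearMap)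

theorem isMirrorMapOn_mirror (hΦX : IsMirrorMapOn ΦX X) (hΦY : IsMirrorMapOn ΦY Y) :
    IsMirrorMapOn (mirror ΦX ΦY) (feasible X Y) := by
  have hd : ∀ z ∈ feasible X Y, HasFDerivAt (mirror ΦX ΦY)
      ((fderiv ℝ ΦX z.fst).comp (WithLp.fstL 2 ℝ E G) +
        (fderiv ℝ ΦY z.snd).comp (WithLp.sndL 2 ℝ E G)) z := fun z hz =>
    ((hΦX.1 _ hz.1).hasFDerivAt.comp z (WithLp.fstL 2 ℝ E G).hasFDerivAt).add
      ((hΦY.1 _ hz.2).hasFDerivAt.comp z (WithLp.sndL 2 ℝ E G).hasFDerivAt)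
  refine ⟨fun z hz => (hd z hz).differentiableAt, fun z hz u hu => ?_⟩
  have h1 := hΦX.2 _ hz.1 _ hu.1
  have h2 := hΦY.2 _ hz.2 _ hu.2
  rw [(hd z hz).fderiv, WithLp.prod_norm_sq_eq_of_L2]
  simp only [mirror, add_apply, ContinuousLinearMap.comp_apply, WithLp.fstL_apply,
    WithLp.sndL_apply, WithLp.sub_fst, WithLp.sub_snd]
  linarith

theorem pairDual_apply (a : StrongDual ℝ E) (b : StrongDual ℝ G) (u : WithLp 2 (E × G)) :
    pairDual a b u = a u.fst + b u.snd := rfl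

theorem contDiffOn_saddleF {U : Set (WithLp 2 (E × G))} (hU : IsOpen U) {q : ℕ}
    (hf : ContDiffOn ℝ (q + 1 : ℕ) f U) : ContDiffOn ℝ q (saddleF f) U := by
  have hd : ContDiffOn ℝ q (fderiv ℝ f) U := hf.fderiv_of_isOpen hU (by norm_cast)
  have hX : ContDiffOn ℝ q (gradX f) U :=
    (hd.clm_comp contDiffOn_const).clm_comp contDiffOn_const
  have hY : ContDiffOn ℝ q (gradY f) U :=
    (hd.clm_comp contDiffOn_const).clm_comp contDiffOn_const
  exact (hX.clm_comp contDiffOn_const).add (hY.neg.clm_comp contDiffOn_const)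

/-- The gradient inequalities in both variables: the operator `F` bounds the primal-dual gap of
`f`. -/
theorem sub_le_saddleF (hcc : IsConvexConcaveOn f X Y) {z u : WithLp 2 (E × G)}
    (hz : z ∈ feasible X Y) (hu : u ∈ feasible X Y) (hd : DifferentiableAt ℝ f z) :
    f (toLp 2 (z.fst, u.snd)) - f (toLp 2 (u.fst, z.snd)) ≤ saddleF f z (z - u) := by
  have hpair : HasFDerivAt (fun q : E × G => f (toLp 2 q)) ((fderiv ℝ f z).comp
      ((WithLp.prodContinuousLinearEquiv 2 ℝ E G).symm : E × G →L[ℝ] WithLp 2 (E × G)))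
      (z.fst, z.snd) :=
    HasFDerivAt.comp (z.fst, z.snd) (g := f) hd.hasFDerivAt
      ((WithLp.prodContinuousLinearEquiv 2 ℝ E G).symm :
        E × G →L[ℝ] WithLp 2 (E × G)).hasFDerivAt
  have hdX : HasFDerivAt (fun x => f (toLp 2 (x, z.snd))) (gradX f z) z.fst :=
    HasFDerivAt.comp (g := fun q : E × G => f (toLp 2 q)) z.fst hpair
      (hasFDerivAt_prodMk_left z.fst z.snd)
  have hdY : HasFDerivAt (fun y => f (toLp 2 (z.fst, y))) (gradY f z) z.snd :=
    HasFDerivAt.comp (g := fun q : E × G => f (toLp 2 q)) z.snd hpair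
      (hasFDerivAt_prodMk_right z.fst z.snd)
  have h1 := ConvexOn.add_fderiv_le (hcc.1 _ hz.2) hz.1 hu.1 hdX
  have h2 := ConvexOn.add_fderiv_le (hcc.2 _ hz.1).neg hz.2 hu.2 hdY.neg
  rw [saddleF, pairDual_apply, WithLp.sub_fst, WithLp.sub_snd]
  simp only [map_sub, neg_apply, Pi.neg_apply] at h1 h2 ⊢
  linarith

theorem saddleF_monotone (hcc : IsConvexConcaveOn f X Y)
    (hd : ∀ z ∈ feasible X Y, DifferentiableAt ℝ f z) {a b : WithLp 2 (E × G)}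
    (ha : a ∈ feasible X Y) (hb : b ∈ feasible X Y) :
    0 ≤ (saddleF f a - saddleF f b) (a - b) := by
  have h1 := sub_le_saddleF hcc ha hb (hd a ha)
  have h2 := sub_le_saddleF hcc hb ha (hd b hb)
  simp only [sub_apply, map_sub] at h1 h2 ⊢
  linarith

/-- The feasible points at which `h₁` and `h₂` are finite. -/
def saddleDomain (X : Set E) (Y : Set G) (h₁ : E → EReal) (h₂ : G → EReal) :
    Set (WithLp 2 (E × G)) :=
  {z | z ∈ feasible X Y ∧ h₁ z.fst ≠ ⊤ ∧ h₂ z.snd ≠ ⊤}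

theorem mem_saddleDomain_of_mem_saddleH (hh₁ : IsProperClosedConvex h₁)
    (hh₂ : IsProperClosedConvex h₂) {z : WithLp 2 (E × G)} {w : StrongDual ℝ (WithLp 2 (E × G))}
    (hw : w ∈ saddleH X Y h₁ h₂ z) : z ∈ saddleDomain X Y h₁ h₂ := by
  obtain ⟨a, ha, m, hm, b, hb, n, hn, -⟩ := hw
  exact ⟨⟨hm.1, hn.1⟩, ne_top_of_mem_subdifferential hh₁ ha, ne_top_of_mem_subdifferential hh₂ hb⟩

theorem le_apply_of_mem_saddleH (hh₁ : IsProperClosedConvex h₁) (hh₂ : IsProperClosedConvex h₂)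
    {z u : WithLp 2 (E × G)} {w : StrongDual ℝ (WithLp 2 (E × G))}
    (hw : w ∈ saddleH X Y h₁ h₂ z) (hu : u ∈ saddleDomain X Y h₁ h₂) :
    (h₁ z.fst).toReal + (h₂ z.snd).toReal - ((h₁ u.fst).toReal + (h₂ u.snd).toReal) ≤
      w (z - u) := by
  obtain ⟨a, ha, m, hm, b, hb, n, hn, rfl⟩ := hw
  have h1 := subdifferential_toReal_le hh₁ ha hu.2.1
  have h2 := subdifferential_toReal_le hh₂ hb hu.2.2
  have h3 := hm.2 _ hu.1.1
  have h4 := hn.2 _ hu.1.2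
  rw [pairDual_apply, WithLp.sub_fst, WithLp.sub_snd]
  simp only [map_sub, add_apply] at h1 h2 h3 h4 ⊢
  linarith

theorem saddleH_monotone (hh₁ : IsProperClosedConvex h₁) (hh₂ : IsProperClosedConvex h₂)
    {z z' : WithLp 2 (E × G)} {w w' : StrongDual ℝ (WithLp 2 (E × G))}
    (hw : w ∈ saddleH X Y h₁ h₂ z) (hw' : w' ∈ saddleH X Y h₁ h₂ z') :
    0 ≤ (w - w') (z - z') := by
  have h1 := le_apply_of_mem_saddleH hh₁ hh₂ hw (mem_saddleDomain_of_mem_saddleH hh₁ hh₂ hw')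
  have h2 := le_apply_of_mem_saddleH hh₁ hh₂ hw' (mem_saddleDomain_of_mem_saddleH hh₁ hh₂ hw)
  simp only [sub_apply, map_sub] at h1 h2 ⊢
  linarith

/-- The primal-dual gap `ℓ(z₁, u₂) - ℓ(u₁, z₂)` as a real number, which is meaningful when `z` and
`u` lie in `saddleDomain`. -/
def realGap (f : WithLp 2 (E × G) → ℝ) (h₁ : E → EReal) (h₂ : G → EReal)
    (u z : WithLp 2 (E × G)) : ℝ :=
  f (toLp 2 (z.fst, u.snd)) + (h₁ z.fst).toReal - (h₂ u.snd).toReal -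
    (f (toLp 2 (u.fst, z.snd)) + (h₁ u.fst).toReal - (h₂ z.snd).toReal)

theorem realGap_le (hh₁ : IsProperClosedConvex h₁) (hh₂ : IsProperClosedConvex h₂)
    (hcc : IsConvexConcaveOn f X Y) {z u : WithLp 2 (E × G)} (hd : DifferentiableAt ℝ f z)
    {w : StrongDual ℝ (WithLp 2 (E × G))} (hw : w ∈ saddleH X Y h₁ h₂ z)
    (hu : u ∈ saddleDomain X Y h₁ h₂) :
    realGap f h₁ h₂ u z ≤ (saddleF f z + w) (z - u) := by
  have h1 := sub_le_saddleF hcc (mem_saddleDomain_of_mem_saddleH hh₁ hh₂ hw).1 hu.1 hd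
  have h2 := le_apply_of_mem_saddleH hh₁ hh₂ hw hu
  rw [realGap, add_apply]
  linarith

theorem convexOn_realGap (hX : Convex ℝ X) (hY : Convex ℝ Y) (hh₁ : IsProperClosedConvex h₁)
    (hh₂ : IsProperClosedConvex h₂) (hcc : IsConvexConcaveOn f X Y) {u : WithLp 2 (E × G)}
    (hu : u ∈ feasible X Y) :
    ConvexOn ℝ (saddleDomain X Y h₁ h₂) (realGap f h₁ h₂ u) := by
  have hdom : Convex ℝ (saddleDomain X Y h₁ h₂) :=
    (convex_feasible hX hY).inter
      ((hh₁.convexOn_toReal.1.linear_preimage (WithLp.fstL 2 ℝ E G).toLinearMap).inter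
        (hh₂.convexOn_toReal.1.linear_preimage (WithLp.sndL 2 ℝ E G).toLinearMap))
  have c1 := ((hcc.1 _ hu.2).comp_linearMap (WithLp.fstL 2 ℝ E G).toLinearMap).subset
    (fun z (hz : z ∈ saddleDomain X Y h₁ h₂) => hz.1.1) hdom
  have c2 := (hh₁.convexOn_toReal.comp_linearMap (WithLp.fstL 2 ℝ E G).toLinearMap).subset
    (fun z (hz : z ∈ saddleDomain X Y h₁ h₂) => hz.2.1) hdom
  have c3 := ((hcc.2 _ hu.1).neg.comp_linearMap (WithLp.sndL 2 ℝ E G).toLinearMap).subset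
    (fun z (hz : z ∈ saddleDomain X Y h₁ h₂) => hz.1.2) hdom
  have c4 := (hh₂.convexOn_toReal.comp_linearMap (WithLp.sndL 2 ℝ E G).toLinearMap).subset
    (fun z (hz : z ∈ saddleDomain X Y h₁ h₂) => hz.2.2) hdom
  refine (((c1.add c2).add (c3.add c4)).add_const
    (-(h₂ u.snd).toReal - (h₁ u.fst).toReal)).congr fun z _ => ?_
  simp only [realGap, Pi.add_apply, Pi.neg_apply, Function.comp_apply,
    ContinuousLinearMap.coe_coe, WithLp.fstL_apply, WithLp.sndL_apply]
  ring

theorem objective_eq_coe (hh₁ : IsProperClosedConvex h₁) (hh₂ : IsProperClosedConvex h₂) {x : E}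
    {y : G} (hx : h₁ x ≠ ⊤) (hy : h₂ y ≠ ⊤) :
    objective f h₁ h₂ x y =
      ((f (toLp 2 (x, y)) + (h₁ x).toReal - (h₂ y).toReal : ℝ) : EReal) := by
  rw [objective]
  push_cast
  rw [EReal.coe_toReal hx (hh₁.ne_bot x), EReal.coe_toReal hy (hh₂.ne_bot y)]

theorem IsSaddlePoint.realGap_nonneg (hh₁ : IsProperClosedConvex h₁)
    (hh₂ : IsProperClosedConvex h₂) {zs z : WithLp 2 (E × G)}
    (hzs : IsSaddlePoint f X Y h₁ h₂ zs) (hz : z ∈ saddleDomain X Y h₁ h₂) :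
    0 ≤ realGap f h₁ h₂ zs z := by
  have h := (hzs.max_snd _ hz.1.2).trans (hzs.min_fst _ hz.1.1)
  rw [objective_eq_coe hh₁ hh₂ hzs.finite_fst hz.2.2,
    objective_eq_coe hh₁ hh₂ hz.2.1 hzs.finite_snd, EReal.coe_le_coe_iff] at h
  exact sub_nonneg.2 h

/-- Where `h₁ x` or `h₂ y` is infinite, the gap is `-∞`, so that only real gaps need a bound. -/
theorem objective_sub_le (hh₁ : IsProperClosedConvex h₁) (hh₂ : IsProperClosedConvex h₂)
    {z : WithLp 2 (E × G)} (hz : z ∈ saddleDomain X Y h₁ h₂) {x : E} {y : G} (hx : x ∈ X)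
    (hy : y ∈ Y) {B : ℝ}
    (h : toLp 2 (x, y) ∈ saddleDomain X Y h₁ h₂ → realGap f h₁ h₂ (toLp 2 (x, y)) z ≤ B) :
    objective f h₁ h₂ z.fst y - objective f h₁ h₂ x z.snd ≤ (B : EReal) := by
  by_cases hx' : h₁ x = ⊤
  · have : objective f h₁ h₂ x z.snd = ⊤ := by
      rw [objective, hx', EReal.coe_add_top, ← EReal.coe_toReal hz.2.2 (hh₂.ne_bot _),
        EReal.top_sub_coe]
    rw [this, EReal.sub_top]
    exact bot_le
  by_cases hy' : h₂ y = ⊤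
  · have : objective f h₁ h₂ z.fst y = ⊥ := by
      rw [objective, hy', EReal.sub_top]
    rw [this, EReal.bot_sub]
    exact bot_le
  rw [objective_eq_coe hh₁ hh₂ hz.2.1 hy', objective_eq_coe hh₁ hh₂ hx' hz.2.2,
    ← EReal.coe_sub, EReal.coe_le_coe_iff]
  exact h ⟨⟨hx, hy⟩, hx', hy'⟩

theorem isRegularProblem_saddle (hX : Convex ℝ X) (hY : Convex ℝ Y)
    (hh₁ : IsProperClosedConvex h₁) (hh₂ : IsProperClosedConvex h₂) {p : ℕ} (hp : 2 ≤ p)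
    {U : Set (WithLp 2 (E × G))} (hU : IsOpen U) (hZU : feasible X Y ⊆ U)
    (hf : ContDiffOn ℝ p f U) (hcc : IsConvexConcaveOn f X Y) {Lp LΦ lam : ℝ}
    (hLp : IsHighOrderSmoothOn p (saddleF f) Lp (feasible X Y)) (hΦX : IsMirrorMapOn ΦX X)
    (hΦY : IsMirrorMapOn ΦY Y) (hLΦ : IsGradLipschitzOn (mirror ΦX ΦY) LΦ (feasible X Y))
    (hlam : Lp ≤ lam) :
    IsRegularProblem p (saddleF f) (saddleH X Y h₁ h₂) (mirror ΦX ΦY) lam LΦ (LpReg p Lp LΦ lam)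
      (feasible X Y) := by
  have hd : ∀ z ∈ feasible X Y, DifferentiableAt ℝ f z := fun z hz =>
    (hf.contDiffAt (hU.mem_nhds (hZU hz))).differentiableAt
      (by exact_mod_cast (by omega : p ≠ 0))
  have hF : ContDiffOn ℝ (p - 1 : ℕ) (saddleF f) U :=
    contDiffOn_saddleF hU (by rwa [Nat.sub_add_cancel (by omega)])
  have hΦ := isMirrorMapOn_mirror hΦX hΦY
  have hZ := convex_feasible hX hY
  have hlam0 : 0 ≤ lam := hLp.1.trans hlam
  exact
    { mem_of_mem_H := fun hw => (mem_saddleDomain_of_mem_saddleH hh₁ hh₂ hw).1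
      H_mono := fun hw hw' => saddleH_monotone hh₁ hh₂ hw hw'
      mirror := hΦ
      smooth := hLΦ
      regTaylor_mono := fun ha hb hz => regTaylor_monotone hU hZU hZ hp hF hLp
        (fun a ha b hb => saddleF_monotone hcc hd ha hb) hΦ hlam ha hb hz
      M_nonneg := add_nonneg hLp.1
        (mul_nonneg (mul_nonneg (Nat.cast_nonneg p) (Real.rpow_nonneg hLΦ.1 _)) hlam0)
      regTaylor_error := fun hw hz =>
        norm_sub_regTaylor_le hU hZU hZ (by omega) hF hLp hΦ hLΦ hlam0 hw hz }

end SaddlePoint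

end

end HighOrderOptimistic

open HighOrderOptimistic in
theorem theorem7p2
    {E G : Type*} [NormedAddCommGroup E] [NormedSpace ℝ E] [FiniteDimensional ℝ E]
    [NormedAddCommGroup G] [NormedSpace ℝ G] [FiniteDimensional ℝ G]
    -- the saddle point problem
    (X : Set E) (Y : Set G) (hXc : IsClosed X) (hX : Convex ℝ X) (hYc : IsClosed Y)
    (hY : Convex ℝ Y)
    (h₁ : E → EReal) (h₂ : G → EReal)
    (hh₁ : IsProperClosedConvex h₁) (hh₂ : IsProperClosedConvex h₂)
    (p : ℕ) (hp : 3 ≤ p)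
    (f : WithLp 2 (E × G) → ℝ) (U : Set (WithLp 2 (E × G))) (hU : IsOpen U)
    (hZU : feasible X Y ⊆ U) (hf : ContDiffOn ℝ p f U) (hcc : IsConvexConcaveOn f X Y)
    (Lp : ℝ) (hLp : IsHighOrderSmoothOn p (saddleF f) Lp (feasible X Y))
    (zs : WithLp 2 (E × G)) (hzs : IsSaddlePoint f X Y h₁ h₂ zs)
    -- the mirror maps
    (ΦX : E → ℝ) (ΦY : G → ℝ) (hΦX : IsMirrorMapOn ΦX X) (hΦY : IsMirrorMapOn ΦY Y)
    (LΦ : ℝ) (hLΦ : IsGradLipschitzOn (mirror ΦX ΦY) LΦ (feasible X Y))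
    -- the parameters and the iterates
    (lam σ₀ α β ε : ℝ) (hlam : Lp ≤ lam) (hσ₀ : 0 < σ₀) (hα₀ : 0 < α) (hα₁ : α < 1)
    (hβ₀ : 0 < β) (hβ₁ : β < 1) (hε : 0 < ε)
    (N : ℕ) (z : ℕ → WithLp 2 (E × G)) (η : ℕ → ℝ) (hz₀ : z 0 ∈ feasible X Y)
    (hrun : IsMethodRun p (saddleF f) (saddleH X Y h₁ h₂) (mirror ΦX ΦY) lam σ₀ α β ε N z η) :
    (∀ k ≤ N,
      bregman (mirror ΦX ΦY) zs (z k) ≤ 2 / (2 - α) * bregman (mirror ΦX ΦY) zs (z 0)) ∧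
    (1 ≤ N →
      residual (saddleF f) (saddleH X Y h₁ h₂) (z N) ≤ ENNReal.ofReal ε ∨
      ∀ x ∈ X, ∀ y ∈ Y,
        objective f h₁ h₂ (averaged N z η).fst y - objective f h₁ h₂ x (averaged N z η).snd ≤
          ((gammaP p LΦ α β ^ (p - 1) * LpReg p Lp LΦ lam *
            bregman (mirror ΦX ΦY) (WithLp.toLp 2 (x, y)) (z 0) *
            bregman (mirror ΦX ΦY) zs (z 0) ^ (((p : ℝ) - 1) / 2) *
            (N : ℝ) ^ (-(((p : ℝ) + 1) / 2)) : ℝ) : EReal)) := by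
  have hP := isRegularProblem_saddle hX hY hh₁ hh₂ (by omega) hU hZU hf hcc hLp hΦX hΦY hLΦ hlam
  obtain ⟨w, hw, henergy⟩ := hrun.energy_inequality hP hz₀ hσ₀ hα₀ hβ₀ hβ₁
  have hη : ∀ k < N, 0 < η k := fun k hk => (hrun.lineSearch_spec hP hz₀ hσ₀ hβ₀ hβ₁ hk).1
  have hmem : ∀ k < N, z (k + 1) ∈ saddleDomain X Y h₁ h₂ := fun k hk =>
    mem_saddleDomain_of_mem_saddleH hh₁ hh₂ (hw k hk)
  have hgap : ∀ u ∈ saddleDomain X Y h₁ h₂, ∀ n ≤ N,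
      ∑ k ∈ Finset.range n, η k * realGap f h₁ h₂ u (z (k + 1)) ≤
        ∑ k ∈ Finset.range n, η k * (saddleF f (z (k + 1)) + w k) (z (k + 1) - u) :=
    fun u hu n hn => Finset.sum_le_sum fun k hk => by
      have hk : k < N := (Finset.mem_range.1 hk).trans_le hn
      have hd : DifferentiableAt ℝ f (z (k + 1)) :=
        (hf.contDiffAt (hU.mem_nhds (hZU (hmem k hk).1))).differentiableAt
          (by exact_mod_cast (by omega : p ≠ 0))
      exact mul_le_mul_of_nonneg_left (realGap_le hh₁ hh₂ hcc hd (hw k hk) hu) (hη k hk).le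
  have hsteps : ∀ n, 0 ≤ (1 - α) / 2 * ∑ k ∈ Finset.range n, ‖z (k + 1) - z k‖ ^ 2 := fun n =>
    mul_nonneg (by linarith) (Finset.sum_nonneg fun k _ => sq_nonneg _)
  have hzsD : zs ∈ saddleDomain X Y h₁ h₂ := ⟨hzs.mem, hzs.finite_fst, hzs.finite_snd⟩
  have hD : ∀ u ∈ feasible X Y, ∀ n ≤ N, 0 ≤ (1 - α / 2) * bregman (mirror ΦX ΦY) u (z n) :=
    fun u hu n hn => mul_nonneg (by linarith) (hP.mirror.bregman_nonneg hu (hrun.mem hP hz₀ hn))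
  have hzs_gap : ∀ n ≤ N, 0 ≤ ∑ k ∈ Finset.range n,
      η k * (saddleF f (z (k + 1)) + w k) (z (k + 1) - zs) := fun n hn =>
    (Finset.sum_nonneg fun k hk => by
      have hk : k < N := (Finset.mem_range.1 hk).trans_le hn
      exact mul_nonneg (hη k hk).le (hzs.realGap_nonneg hh₁ hh₂ (hmem k hk))).trans
      (hgap zs hzsD n hn)
  refine ⟨fun k hk => ?_, fun hN => or_iff_not_imp_left.2 fun hres x hx y hy => ?_⟩
  · have h1 := henergy zs hzs.mem k hk
    have h2 := hzs_gap k hk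
    have h3 := hsteps k
    rw [div_mul_eq_mul_div, le_div_iff₀ (by linarith)]
    linarith
  · have hsum : 0 < ∑ k ∈ Finset.range N, η k :=
      Finset.sum_pos (fun k hk => hη k (Finset.mem_range.1 hk)) ⟨0, Finset.mem_range.2 hN⟩
    have hη0 : ∀ k ∈ Finset.range N, 0 ≤ η k := fun k hk => (hη k (Finset.mem_range.1 hk)).le
    have hmem' : ∀ k ∈ Finset.range N, z (k + 1) ∈ saddleDomain X Y h₁ h₂ := fun k hk =>
      hmem k (Finset.mem_range.1 hk)
    have hconv := fun {u} hu => convexOn_realGap (u := u) hX hY hh₁ hh₂ hcc hu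
    have havg : averaged N z η ∈ saddleDomain X Y h₁ h₂ :=
      (hconv hzs.mem).1.centerMass_mem hη0 hsum hmem'
    refine objective_sub_le hh₁ hh₂ havg hx hy fun hu => ?_
    set u : WithLp 2 (E × G) := WithLp.toLp 2 (x, y) with hudef
    have hjensen : realGap f h₁ h₂ u (averaged N z η) ≤ (∑ k ∈ Finset.range N, η k)⁻¹ *
        ∑ k ∈ Finset.range N, η k * realGap f h₁ h₂ u (z (k + 1)) :=
      (hconv hu.1).map_centerMass_le hη0 hsum hmem'
    have hDu := hP.mirror.bregman_nonneg hu.1 hz₀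
    have hgapN : ∑ k ∈ Finset.range N, η k * realGap f h₁ h₂ u (z (k + 1)) ≤
        bregman (mirror ΦX ΦY) u (z 0) := by
      have h1 := henergy u hu.1 N le_rfl
      have h2 := hgap u hu N le_rfl
      have h3 := hsteps N
      have h4 := hD u hu.1 N le_rfl
      linarith
    have hzsN : (1 - α) / 2 * ∑ k ∈ Finset.range N, ‖z (k + 1) - z k‖ ^ 2 ≤
        bregman (mirror ΦX ΦY) zs (z 0) := by
      have h1 := henergy zs hzs.mem N le_rfl
      have h2 := hzs_gap N le_rfl
      have h4 := hD zs hzs.mem N le_rfl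
      linarith
    have hrate := hrun.inv_sum_stepsize_le hP (by omega) hz₀ hσ₀ hα₀ hα₁ hβ₀ hβ₁ hN
      (not_le.1 hres) (hP.mirror.bregman_nonneg hzs.mem hz₀) hzsN
    calc realGap f h₁ h₂ u (averaged N z η) ≤ (∑ k ∈ Finset.range N, η k)⁻¹ *
          bregman (mirror ΦX ΦY) u (z 0) :=
        hjensen.trans (mul_le_mul_of_nonneg_left hgapN (inv_nonneg.2 hsum.le))
      _ ≤ _ := mul_le_mul_of_nonneg_right hrate hDu
      _ = _ := by ring
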